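/- Consider finite undirected graphs, not necessarily simple (parallel edges and loops are allowed, every edge, loops included, has two orientations, and a loop contributes $2$ to the degree of its vertex), with at least one vertex and with minimum degree at least $3$. An orientation of such a graph $G$ is sink-free if every vertex has at least one outgoing edge. There exist a randomised algorithm and an absolute constant $C$ such that the following holds. For every such graph $G$ with $m$ edges and every real $0<\varepsilon<1$, $G$ has a sink-free orientation, and the algorithm, given the list of edges of $G$ and the binary digits of $\varepsilon$, always halts within $C\,m\log(m/\varepsilon)$ steps and outputs a random orientation $\sigma$ of $G$ whose distribution $\nu$ satisfies $$d_{\mathrm{TV}}(\nu,\mu)=\frac12\sum_{\tau}|\nu(\tau)-\mu(\tau)|\le\varepsilon,$$ where $\mu$ is the uniform distribution on the sink-free orientations of $G$ and the sum is over all orientations $\tau$ of $G$. Here the algorithm is a single program for a random access machine with fair coin tosses, in which every elementary instruction (assignment, increment or decrement of a register, array access, comparison, coin toss) takes one step. -/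

import Mathlib

/-! ## Graphs, orientations, sinks -/

/-- A finite undirected multigraph on the vertices `0, …, n-1` with edges `0, …, m-1`, presented
as a list of edges. Parallel edges and loops are allowed. The order of the two endpoints of an edge
carries no information about the graph: it only serves to name the two directions of the edge. -/
structure EdgeListGraph (n m : ℕ) where
  fst : Fin m → Fin n
  snd : Fin m → Fin n

namespace EdgeListGraph

variable {n m : ℕ}

/-- The degree of a vertex; a loop counts twice. -/
def degree (G : EdgeListGraph n m) (v : Fin n) : ℕ :=
  (Finset.univ.filter fun e => G.fst e = v).card + (Finset.univ.filter fun e => G.snd e = v).card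

/-- An orientation chooses one of the two directions of each edge:
`true` directs `e` from `fst e` to `snd e`, and `false` directs it from `snd e` to `fst e`. -/
abbrev Orientation (_G : EdgeListGraph n m) : Type := Fin m → Bool

/-- The vertex that the edge `e` leaves in the orientation `σ`. -/
def tail (G : EdgeListGraph n m) (σ : G.Orientation) (e : Fin m) : Fin n :=
  if σ e then G.fst e else G.snd e

/-- A sink is a vertex without outgoing edges. -/
def IsSink (G : EdgeListGraph n m) (σ : G.Orientation) (v : Fin n) : Prop :=
  ∀ e, G.tail σ e ≠ v

open Classical in
/-- The set of sink-free orientations. -/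
noncomputable def sinkFree (G : EdgeListGraph n m) : Finset G.Orientation :=
  Finset.univ.filter fun σ => ∀ v, ¬ G.IsSink σ v

end EdgeListGraph

/-- Total variation distance of two distributions on a finite set. -/
noncomputable def tvDist {α : Type*} [Fintype α] (p q : PMF α) : ℝ :=
  (∑ x, |(p x).toReal - (q x).toReal|) / 2

/-! ## A randomised random access machine with unit costs

The machine has scalar registers and arrays, both named by natural numbers, that hold natural
numbers; a program, being finite, mentions finitely many of them. The only arithmetic operations
are `+ 1` and `- 1`, so that after `t` steps no number exceeds the largest number of the program
and of the input by more than `t`: charging one unit per operation hides no work on long numbers. -/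

namespace RAM

/-- The contents of the memory. -/
structure Store where
  reg : ℕ → ℕ
  arr : ℕ → ℕ → ℕ

/-- `x := a` -/
def Store.setReg (s : Store) (x a : ℕ) : Store :=
  { s with reg := Function.update s.reg x a }

/-- `A[i] := a`, where `A` is the array with name `j`. -/
def Store.setArr (s : Store) (j i a : ℕ) : Store :=
  { s with arr := Function.update s.arr j (Function.update (s.arr j) i a) }

/-- Comparisons of two registers. -/
inductive Test where
  | eq (x y : ℕ)
  | ne (x y : ℕ)
  | lt (x y : ℕ)
  | le (x y : ℕ)

/-- The outcome of a comparison. -/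
def Test.eval (s : Store) : Test → Bool
  | .eq x y => decide (s.reg x = s.reg y)
  | .ne x y => decide (s.reg x ≠ s.reg y)
  | .lt x y => decide (s.reg x < s.reg y)
  | .le x y => decide (s.reg x ≤ s.reg y)

/-- Programs. -/
inductive Program where
  /-- do nothing -/
  | skip
  /-- `x := a` for a constant `a` -/
  | const (x a : ℕ)
  /-- `x := y` -/
  | copy (x y : ℕ)
  /-- `x := x + 1` -/
  | inc (x : ℕ)
  /-- `x := x - 1`, and `0` stays `0` -/
  | dec (x : ℕ)
  /-- `x := A[i]`, where `A` is the array with name `j` and `i` is the content of register `y` -/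
  | load (x j y : ℕ)
  /-- `A[i] := x`, where `A` is the array with name `j` and `i` is the content of register `y` -/
  | store (j y x : ℕ)
  /-- `x` becomes the result in `{0, 1}` of a fresh toss of a fair coin -/
  | flip (x : ℕ)
  /-- first `p`, then `q` -/
  | seq (p q : Program)
  /-- conditional -/
  | ite (b : Test) (p q : Program)
  /-- loop -/
  | while (b : Test) (p : Program)

/-- A configuration: what remains to be executed, first item first, and the memory. -/
abbrev Config : Type := List Program × Store

/-- The machine has halted when nothing remains to be executed. -/
def Halted (c : Config) : Prop := c.1 = []

/-- One step of the machine, as a distribution on the next configuration. Each elementary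
instruction, each evaluation of a test and each unfolding of `seq` takes one step. -/
noncomputable def step : Config → PMF Config
  | ([], s) => PMF.pure ([], s)
  | (.skip :: k, s) => PMF.pure (k, s)
  | (.const x a :: k, s) => PMF.pure (k, s.setReg x a)
  | (.copy x y :: k, s) => PMF.pure (k, s.setReg x (s.reg y))
  | (.inc x :: k, s) => PMF.pure (k, s.setReg x (s.reg x + 1))
  | (.dec x :: k, s) => PMF.pure (k, s.setReg x (s.reg x - 1))
  | (.load x j y :: k, s) => PMF.pure (k, s.setReg x (s.arr j (s.reg y)))
  | (.store j y x :: k, s) => PMF.pure (k, s.setArr j (s.reg y) (s.reg x))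
  | (.flip x :: k, s) => (PMF.uniformOfFintype Bool).map fun b => (k, s.setReg x b.toNat)
  | (.seq p q :: k, s) => PMF.pure (p :: q :: k, s)
  | (.ite b p q :: k, s) => PMF.pure ((if b.eval s then p else q) :: k, s)
  | (.while b p :: k, s) => PMF.pure (if b.eval s then p :: .while b p :: k else k, s)

/-- The distribution of the configuration after `t` steps. -/
noncomputable def run : ℕ → Config → PMF Config
  | 0, c => PMF.pure c
  | t + 1, c => (step c).bind (run t)

end RAM

/-! ## Input and output of a sampling algorithm -/

namespace EdgeListGraph

variable {n m : ℕ}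

/-- The initial memory for the graph `G` and the accuracy `ε ∈ (0, 1)`: registers `0` and `1` hold
`n` and `m`, arrays `0` and `1` hold the list of edges, and array `2` holds the digits after the
point of the binary expansion of `ε`. Everything else is `0`. -/
noncomputable def input (G : EdgeListGraph n m) (ε : ℝ) : RAM.Store where
  reg
    | 0 => n
    | 1 => m
    | _ => 0
  arr
    | 0 => fun e => if h : e < m then (G.fst ⟨e, h⟩ : ℕ) else 0
    | 1 => fun e => if h : e < m then (G.snd ⟨e, h⟩ : ℕ) else 0
    | 2 => fun i => (Real.digits ε 2 i : ℕ)
    | _ => fun _ => 0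

/-- The orientation that is read off from the final memory: array `3` holds a nonzero entry
for the edges directed from `fst` to `snd`, and a zero for the other edges. -/
def output (G : EdgeListGraph n m) (c : RAM.Config) : G.Orientation :=
  fun e => decide (c.2.arr 3 e ≠ 0)

/-- The distribution of the output of the program `p` on `G` and `ε`, read after `t` steps. -/
noncomputable def outputDist (G : EdgeListGraph n m) (ε : ℝ) (p : RAM.Program) (t : ℕ) :
    PMF G.Orientation :=
  (RAM.run t ([p], G.input ε)).map G.output

end EdgeListGraph

/-!
Start from a uniform orientation and, in each round, orient all edges at the current sinks afresh.
Two sinks are never adjacent, so exchanging the values of two orientations on the edges at `J` turns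
the pairs of an orientation with set of sinks `J` and an arbitrary one bijectively into the pairs of
an orientation without sinks outside the closed neighbourhood `N[J]` and one in which all of `J` are
sinks. Hence a round, conditioned on the set of sinks `J`, leads to the uniform distribution on the
orientations without sinks outside `N[J]`. By induction on `S`, a uniform orientation without sinks
in `S` has a given sink `v` with a probability so small, compared to `1 / (deg v + 1)`, that the
expected size of `N[J]` is at most `25/32` times the number of vertices outside `S`. Therefore
`O(log (n / ε))` rounds suffice, and each takes `O(m)` steps. The binary digits of `ε` are needed
only up to the first nonzero one.
-/

/-! ## Uniform distributions and total variation distance -/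

section UniformPMF

variable {α β γ δ ι : Type*}

theorem uniformOfFinset_bind_apply {s : Finset α} (hs : s.Nonempty) (κ : α → PMF β) (b : β) :
    (PMF.uniformOfFinset s hs).bind κ b = (s.card : ENNReal)⁻¹ * ∑ a ∈ s, κ a b := by
  rw [PMF.bind_apply, tsum_eq_sum (s := s), Finset.mul_sum]
  · exact Finset.sum_congr rfl fun a ha => by rw [PMF.uniformOfFinset_apply_of_mem hs ha]
  · exact fun a ha => by rw [PMF.uniformOfFinset_apply_of_notMem hs ha, zero_mul]

theorem uniformOfFinset_bind_congr {s : Finset α} (hs : s.Nonempty) {κ₁ κ₂ : α → PMF β}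
    (h : ∀ a ∈ s, κ₁ a = κ₂ a) :
    (PMF.uniformOfFinset s hs).bind κ₁ = (PMF.uniformOfFinset s hs).bind κ₂ := by
  ext b
  rw [uniformOfFinset_bind_apply, uniformOfFinset_bind_apply]
  congr 1
  exact Finset.sum_congr rfl fun a ha => by rw [h a ha]

theorem map_uniformOfFinset_of_bijOn {s : Finset α} {t : Finset β} (hs : s.Nonempty)
    (ht : t.Nonempty) {f : α → β} (hf : Set.BijOn f s t) :
    (PMF.uniformOfFinset s hs).map f = PMF.uniformOfFinset t ht := by
  classical
  ext b
  rw [PMF.map, uniformOfFinset_bind_apply]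
  simp only [Function.comp_apply, PMF.pure_apply]
  by_cases hb : b ∈ t
  · obtain ⟨a, ha, rfl⟩ := hf.surjOn hb
    rw [PMF.uniformOfFinset_apply_of_mem _ hb, Finset.card_nbij f hf.mapsTo hf.injOn hf.surjOn,
      Finset.sum_eq_single_of_mem a ha, if_pos rfl, mul_one]
    exact fun a' ha' hne => if_neg fun heq => hne (hf.injOn ha' ha heq.symm)
  · rw [PMF.uniformOfFinset_apply_of_notMem _ hb, Finset.sum_eq_zero, mul_zero]
    exact fun a ha => if_neg fun heq => hb (by rw [heq]; exact hf.mapsTo ha)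

theorem uniformOfFinset_bind_map_prodMk {s : Finset α} {t : Finset β} (hs : s.Nonempty)
    (ht : t.Nonempty) :
    ((PMF.uniformOfFinset s hs).bind fun a => (PMF.uniformOfFinset t ht).map (Prod.mk a)) =
      PMF.uniformOfFinset (s ×ˢ t) (hs.product ht) := by
  classical
  ext ⟨a, b⟩
  have hcoord : ∀ a', (PMF.uniformOfFinset t ht).map (Prod.mk a') (a, b) =
      if a = a' then PMF.uniformOfFinset t ht b else 0 := fun a' => by
    rw [PMF.map_apply]
    by_cases h : a = a' <;> simp [h]
  rw [uniformOfFinset_bind_apply]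
  simp only [hcoord, Finset.sum_ite_eq, PMF.uniformOfFinset_apply, Finset.mem_product]
  by_cases ha : a ∈ s <;> by_cases hb : b ∈ t <;>
    simp [ha, hb, Finset.card_product, ENNReal.mul_inv]

theorem uniformOfFinset_bind_map_of_bijOn {A : Finset α} {B : Finset β} {C : Finset γ}
    {D : Finset δ} (hA : A.Nonempty) (hB : B.Nonempty) (hC : C.Nonempty) {f : α → β → γ}
    {g : α → β → δ} (h : Set.BijOn (fun p : α × β => (f p.1 p.2, g p.1 p.2))
      ((A ×ˢ B : Finset (α × β)) : Set (α × β)) ((C ×ˢ D : Finset (γ × δ)) : Set (γ × δ))) :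
    ((PMF.uniformOfFinset A hA).bind fun a => (PMF.uniformOfFinset B hB).map (f a)) =
      PMF.uniformOfFinset C hC := by
  obtain ⟨p, hp⟩ := hA.product hB
  have hD : D.Nonempty := ⟨_, (Finset.mem_product.1 (h.mapsTo hp)).2⟩
  calc ((PMF.uniformOfFinset A hA).bind fun a => (PMF.uniformOfFinset B hB).map (f a))
      = ((PMF.uniformOfFinset (A ×ˢ B) (hA.product hB)).map
          fun p => (f p.1 p.2, g p.1 p.2)).map Prod.fst := by
        rw [← uniformOfFinset_bind_map_prodMk hA hB, PMF.map_comp, PMF.map_bind]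
        simp only [PMF.map_comp]
        rfl
    _ = ((PMF.uniformOfFinset C hC).bind fun c =>
          (PMF.uniformOfFinset D hD).map (Prod.mk c)).map Prod.fst := by
        rw [map_uniformOfFinset_of_bijOn _ (hC.product hD) h, uniformOfFinset_bind_map_prodMk]
    _ = PMF.uniformOfFinset C hC := by
        rw [PMF.map_bind]
        simp only [PMF.map_comp]
        exact (congrArg _ (funext fun c => PMF.map_const _ c)).trans (PMF.bind_pure _)

theorem uniformOfFintype_bind_map_of_bijective [Fintype α] [Nonempty α] [Fintype β] [Nonempty β]
    [Fintype γ] [Nonempty γ] {f : α → β → γ} {g : α → β → δ}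
    (h : Function.Bijective fun p : α × β => (f p.1 p.2, g p.1 p.2)) :
    ((PMF.uniformOfFintype α).bind fun a => (PMF.uniformOfFintype β).map (f a)) =
      PMF.uniformOfFintype γ := by
  have : Finite δ := Finite.of_surjective _ (Prod.snd_surjective.comp h.surjective)
  have := Fintype.ofFinite δ
  refine uniformOfFinset_bind_map_of_bijOn (D := Finset.univ) _ _ _ (g := g) ?_
  rwa [Finset.univ_product_univ, Finset.univ_product_univ, Finset.coe_univ, Finset.coe_univ,
    Set.bijOn_univ]

theorem uniformOfFinset_bind_congr_fiberwise [DecidableEq ι] {s : Finset α} (hs : s.Nonempty)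
    (g : α → ι) {κ₁ κ₂ : α → PMF β}
    (h : ∀ i (hi : (s.filter fun a => g a = i).Nonempty),
      (PMF.uniformOfFinset _ hi).bind κ₁ = (PMF.uniformOfFinset _ hi).bind κ₂) :
    (PMF.uniformOfFinset s hs).bind κ₁ = (PMF.uniformOfFinset s hs).bind κ₂ := by
  ext b
  rw [uniformOfFinset_bind_apply, uniformOfFinset_bind_apply]
  have hmaps : ∀ a ∈ s, g a ∈ s.image g := fun a => Finset.mem_image_of_mem g
  rw [← Finset.sum_fiberwise_of_maps_to hmaps, ← Finset.sum_fiberwise_of_maps_to hmaps]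
  congr 1
  refine Finset.sum_congr rfl fun i hi => ?_
  obtain ⟨a, ha, rfl⟩ := Finset.mem_image.1 hi
  have hne : (s.filter fun a' => g a' = g a).Nonempty := ⟨a, by simp [ha]⟩
  have heq := congrArg (fun p : PMF β => p b) (h _ hne)
  simp only [uniformOfFinset_bind_apply] at heq
  exact (ENNReal.mul_right_inj (ENNReal.inv_ne_zero.2 (ENNReal.natCast_ne_top _))
    (ENNReal.inv_ne_top.2 (by exact_mod_cast hne.card_ne_zero))).1 heq

theorem toReal_uniformOfFinset_bind_apply {s : Finset α} (hs : s.Nonempty)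
    (κ : α → PMF β) (b : β) :
    ((PMF.uniformOfFinset s hs).bind κ b).toReal = (∑ a ∈ s, (κ a b).toReal) / s.card := by
  rw [uniformOfFinset_bind_apply, ENNReal.toReal_mul,
    ENNReal.toReal_sum fun a _ => (κ a).apply_ne_top b, ENNReal.toReal_inv, ENNReal.toReal_natCast,
    div_eq_inv_mul]

end UniformPMF

section TVDist

variable {α β : Type*} [Fintype β]

theorem tvDist_self (p : PMF β) : tvDist p p = 0 := by
  simp [tvDist]

theorem sum_toReal_apply (p : PMF β) : ∑ b, (p b).toReal = 1 := by
  rw [← ENNReal.toReal_sum fun b _ => p.apply_ne_top b,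
    ← tsum_fintype (L := .unconditional β), p.tsum_coe, ENNReal.toReal_one]

theorem tvDist_le_one (p q : PMF β) : tvDist p q ≤ 1 := by
  have h : ∑ b, |(p b).toReal - (q b).toReal| ≤ ∑ b, ((p b).toReal + (q b).toReal) := by
    refine Finset.sum_le_sum fun b _ => (abs_sub _ _).trans ?_
    rw [abs_of_nonneg ENNReal.toReal_nonneg, abs_of_nonneg ENNReal.toReal_nonneg]
  rw [Finset.sum_add_distrib, sum_toReal_apply, sum_toReal_apply] at h
  rw [tvDist]
  linarith

theorem tvDist_uniformOfFinset_bind_le {s : Finset α} (hs : s.Nonempty) (κ : α → PMF β)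
    (q : PMF β) :
    tvDist ((PMF.uniformOfFinset s hs).bind κ) q ≤ (∑ a ∈ s, tvDist (κ a) q) / s.card := by
  have hcard : (0 : ℝ) < s.card := by exact_mod_cast hs.card_pos
  have hpoint : ∀ b, |((PMF.uniformOfFinset s hs).bind κ b).toReal - (q b).toReal| ≤
      (∑ a ∈ s, |(κ a b).toReal - (q b).toReal|) / s.card := fun b => by
    rw [toReal_uniformOfFinset_bind_apply, div_sub' hcard.ne', abs_div, abs_of_pos hcard,
      ← nsmul_eq_mul, ← Finset.sum_const, ← Finset.sum_sub_distrib]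
    gcongr
    exact Finset.abs_sum_le_sum_abs _ _
  calc tvDist ((PMF.uniformOfFinset s hs).bind κ) q
      ≤ (∑ b, (∑ a ∈ s, |(κ a b).toReal - (q b).toReal|) / s.card) / 2 := by
        rw [tvDist]
        gcongr with b
        exact hpoint b
    _ = (∑ a ∈ s, tvDist (κ a) q) / s.card := by
        simp only [tvDist]
        rw [← Finset.sum_div, Finset.sum_comm, ← Finset.sum_div, div_right_comm]

end TVDist

/-! ## Resampling coordinates -/

section Resample

theorem piecewise_swap_involutive {ι β : Type*} [DecidableEq ι] (D : Finset ι) :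
    Function.Involutive fun p : (ι → β) × (ι → β) =>
      (D.piecewise p.2 p.1, D.piecewise p.1 p.2) := fun p => by
  ext e <;> by_cases he : e ∈ D <;> simp [he]

variable {ι β : Type*} [Fintype ι] [DecidableEq ι] [Fintype β] [Nonempty β]

/-- The random function obtained from `σ` by replacing its values on `D` with independent uniform
ones. -/
noncomputable def resample (D : Finset ι) (σ : ι → β) : PMF (ι → β) :=
  (PMF.uniformOfFintype (ι → β)).map fun ρ => D.piecewise ρ σ

theorem resample_empty (σ : ι → β) : resample ∅ σ = PMF.pure σ := by
  simp only [resample, Finset.piecewise_empty]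
  exact PMF.map_const _ _

theorem resample_univ (σ : ι → β) : resample Finset.univ σ = PMF.uniformOfFintype (ι → β) := by
  simp only [resample, Finset.piecewise_univ]
  exact PMF.map_id _

theorem resample_singleton (e : ι) (σ : ι → β) :
    resample {e} σ = (PMF.uniformOfFintype β).map (Function.update σ e) := by
  have hbij : Function.Bijective fun p : (ι → β) × β => (p.1 e, Function.update p.1 e p.2) :=
    Function.bijective_iff_has_inverse.2 ⟨fun q => (Function.update q.2 e q.1, q.2 e),
      fun _ => by simp, fun _ => by simp⟩
  calc resample {e} σ
      = ((PMF.uniformOfFintype (ι → β)).map fun ρ => ρ e).map (Function.update σ e) := by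
        simp only [resample, Finset.piecewise_singleton, PMF.map_comp, Function.comp_def]
    _ = (PMF.uniformOfFintype β).map (Function.update σ e) := by
        rw [← uniformOfFintype_bind_map_of_bijective (f := fun (ρ : ι → β) _ => ρ e)
          (g := fun ρ b => Function.update ρ e b) hbij]
        exact congrArg _ (congrArg _ (funext fun ρ => (PMF.map_const _ _).symm))

theorem resample_bind_resample (D E : Finset ι) (σ : ι → β) :
    (resample D σ).bind (resample E) = resample (D ∪ E) σ := by
  have hpiecewise : ∀ ρ ρ' : ι → β, E.piecewise ρ' (D.piecewise ρ σ) =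
      (D ∪ E).piecewise (E.piecewise ρ' ρ) σ := fun ρ ρ' => by
    ext e
    by_cases hD : e ∈ D <;> by_cases hE : e ∈ E <;> simp [hD, hE]
  calc (resample D σ).bind (resample E)
      = ((PMF.uniformOfFintype (ι → β)).bind fun ρ => (PMF.uniformOfFintype (ι → β)).map
          fun ρ' => E.piecewise ρ' ρ).map fun ρ => (D ∪ E).piecewise ρ σ := by
        simp only [resample, PMF.bind_map, PMF.map_bind, PMF.map_comp, Function.comp_def,
          hpiecewise]
    _ = resample (D ∪ E) σ :=
        congrArg _ (uniformOfFintype_bind_map_of_bijective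
          (g := fun ρ ρ' => E.piecewise ρ ρ') (piecewise_swap_involutive E).bijective)

end Resample

/-! ## Sink popping -/

namespace EdgeListGraph

variable {n m : ℕ}

/-- The vertex that the edge `e` enters in the orientation `σ`. -/
def head (G : EdgeListGraph n m) (σ : G.Orientation) (e : Fin m) : Fin n :=
  if σ e then G.snd e else G.fst e

open Classical in
/-- The edges that enter sinks. -/
noncomputable def sinkEdges (G : EdgeListGraph n m) (σ : G.Orientation) : Finset (Fin m) :=
  Finset.univ.filter fun e => G.IsSink σ (G.head σ e)

/-- One round of sink popping: the edges that enter sinks are oriented afresh. -/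
noncomputable def popSinks (G : EdgeListGraph n m) (σ : G.Orientation) : PMF G.Orientation :=
  resample (G.sinkEdges σ) σ

/-- The given number of rounds of sink popping. -/
noncomputable def iteratePopSinks (G : EdgeListGraph n m) : ℕ → G.Orientation → PMF G.Orientation
  | 0, σ => PMF.pure σ
  | r + 1, σ => (G.popSinks σ).bind (G.iteratePopSinks r)

end EdgeListGraph

/-! ## Counting orientations by their sinks -/

theorem two_pow_card_mul_card_filter_forall_eq {ι : Type*} [Fintype ι] [DecidableEq ι]
    (D : Finset ι) (σ : ι → Bool) :
    2 ^ D.card * (Finset.univ.filter fun ρ : ι → Bool => ∀ i ∈ D, ρ i = σ i).card =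
      2 ^ Fintype.card ι := by
  have hpi : (Finset.univ.filter fun ρ : ι → Bool => ∀ i ∈ D, ρ i = σ i) =
      Fintype.piFinset fun i => if i ∈ D then {σ i} else Finset.univ := by
    ext ρ
    simp only [Finset.mem_filter, Finset.mem_univ, true_and, Fintype.mem_piFinset]
    refine forall_congr' fun i => ?_
    split_ifs with hi <;> simp [hi]
  rw [hpi, Fintype.card_piFinset]
  simp only [apply_ite Finset.card, Finset.card_singleton, Finset.card_univ, Fintype.card_bool]
  rw [Finset.prod_ite, Finset.prod_const_one, one_mul, Finset.prod_const, ← pow_add]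
  congr 1
  rw [← Finset.compl_filter, Finset.filter_univ_mem, Finset.card_add_card_compl]

theorem eight_fifths_pow_le {d k : ℕ} (hk : k ≤ d) : (8 / 5 : ℝ) ^ d ≤ (4 / 5) ^ k * 2 ^ d :=
  calc (8 / 5 : ℝ) ^ d = (4 / 5) ^ d * 2 ^ d := by rw [← mul_pow]; norm_num
    _ ≤ (4 / 5) ^ k * 2 ^ d := by
      gcongr 1
      exact pow_le_pow_of_le_one (by norm_num) (by norm_num) hk

theorem pow_card_mul_le_of_forall_insert {α : Type*} [DecidableEq α] {f : Finset α → ℝ} {c : ℝ}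
    (hc : 0 ≤ c) {S U : Finset α} (hSU : Disjoint S U)
    (h : ∀ T ⊆ S ∪ U, ∀ u ∈ U, u ∉ T → c * f T ≤ f (insert u T)) :
    c ^ U.card * f S ≤ f (S ∪ U) := by
  induction U using Finset.induction_on with
  | empty => simp
  | insert u U hu ih =>
    rw [Finset.disjoint_insert_right] at hSU
    have hsub : S ∪ U ⊆ S ∪ insert u U :=
      Finset.union_subset_union_right (Finset.subset_insert u U)
    calc c ^ (insert u U).card * f S = c * (c ^ U.card * f S) := by
          rw [Finset.card_insert_of_notMem hu]; ring
      _ ≤ c * f (S ∪ U) := by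
          gcongr
          exact ih hSU.2 fun T hT w hw => h T (hT.trans hsub) w (Finset.mem_insert_of_mem hw)
      _ ≤ f (S ∪ insert u U) := by
          rw [Finset.union_insert]
          exact h _ hsub u (Finset.mem_insert_self u U) (by simp [hSU.1, hu])

theorem add_four_le_mul_pow (d : ℕ) : (d : ℝ) + 4 ≤ 25 / 16 * (8 / 5) ^ (d + 2) := by
  have hbernoulli := one_add_mul_le_pow (a := (3 / 5 : ℝ)) (by norm_num) d
  rw [pow_add]
  norm_num at hbernoulli ⊢
  nlinarith

namespace EdgeListGraph

variable {n m : ℕ} (G : EdgeListGraph n m)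

/-- The edges with an endpoint in `J`. -/
def edgesAt (J : Finset (Fin n)) : Finset (Fin m) :=
  Finset.univ.filter fun e => G.fst e ∈ J ∨ G.snd e ∈ J

/-- The neighbours of a vertex; a vertex with a loop is its own neighbour. -/
def neighbors (v : Fin n) : Finset (Fin n) :=
  (Finset.univ.filter fun e => G.fst e = v).image G.snd ∪
    (Finset.univ.filter fun e => G.snd e = v).image G.fst

/-- The vertices of `J` and their neighbours. -/
def closedNeighbors (J : Finset (Fin n)) : Finset (Fin n) := J ∪ J.biUnion G.neighbors

open Classical in
/-- The set of sinks of an orientation. -/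
noncomputable def sinks (σ : G.Orientation) : Finset (Fin n) :=
  Finset.univ.filter fun v => G.IsSink σ v

open Classical in
/-- The orientations in which no vertex of `S` is a sink. -/
noncomputable def sinkFreeOn (S : Finset (Fin n)) : Finset G.Orientation :=
  Finset.univ.filter fun σ => ∀ v ∈ S, ¬ G.IsSink σ v

open Classical in
/-- The orientations in which no vertex of `S` is a sink, but `v` is one. -/
noncomputable def sinkFreeOnWithSink (S : Finset (Fin n)) (v : Fin n) : Finset G.Orientation :=
  (G.sinkFreeOn S).filter fun σ => G.IsSink σ v

variable {G} {S J : Finset (Fin n)} {σ ρ : G.Orientation} {u v : Fin n} {e : Fin m}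

theorem mem_sinks : v ∈ G.sinks σ ↔ G.IsSink σ v := by
  simp [sinks]

theorem mem_sinkFreeOn : σ ∈ G.sinkFreeOn S ↔ ∀ v ∈ S, ¬ G.IsSink σ v := by
  simp [sinkFreeOn]

theorem mem_sinkFreeOnWithSink :
    σ ∈ G.sinkFreeOnWithSink S v ↔ σ ∈ G.sinkFreeOn S ∧ G.IsSink σ v := by
  simp [sinkFreeOnWithSink]

theorem mem_edgesAt (σ : G.Orientation) :
    e ∈ G.edgesAt J ↔ G.tail σ e ∈ J ∨ G.head σ e ∈ J := by
  cases h : σ e <;> simp [edgesAt, tail, head, h, or_comm]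

theorem mem_neighbors (σ : G.Orientation) : u ∈ G.neighbors v ↔
    ∃ e, (G.tail σ e = v ∧ G.head σ e = u) ∨ (G.head σ e = v ∧ G.tail σ e = u) := by
  simp only [neighbors, Finset.mem_union, Finset.mem_image, Finset.mem_filter, Finset.mem_univ,
    true_and, ← exists_or]
  refine exists_congr fun e => ?_
  cases h : σ e <;> simp [tail, head, h, or_comm]

theorem neighbors_symm (h : u ∈ G.neighbors v) : v ∈ G.neighbors u := by
  obtain ⟨e, he⟩ := (mem_neighbors fun _ => true).1 h
  exact (mem_neighbors fun _ => true).2 ⟨e, he.symm.imp And.symm And.symm⟩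

theorem card_neighbors_le (v : Fin n) : (G.neighbors v).card ≤ G.degree v :=
  (Finset.card_union_le _ _).trans (add_le_add Finset.card_image_le Finset.card_image_le)

theorem card_inter_neighbors_lt (huv : u ∈ G.neighbors v) (hu : u ∉ S) :
    (S ∩ G.neighbors v).card < G.degree v :=
  (Finset.card_lt_card (Finset.ssubset_iff_of_subset Finset.inter_subset_right |>.2
    ⟨u, huv, fun h => hu (Finset.mem_inter.1 h).1⟩)).trans_le (card_neighbors_le v)

theorem tail_congr (h : σ e = ρ e) : G.tail σ e = G.tail ρ e := by
  rw [tail, tail, h]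

theorem head_eq_tail_of_ne (h : σ e ≠ ρ e) : G.head σ e = G.tail ρ e := by
  cases hσ : σ e <;> cases hρ : ρ e <;> simp_all [head, tail]

theorem isSink_congr (h : ∀ e ∈ G.edgesAt {v}, σ e = ρ e) : G.IsSink σ v ↔ G.IsSink ρ v := by
  refine forall_congr' fun e => ?_
  by_cases he : e ∈ G.edgesAt {v}
  · rw [tail_congr (h e he)]
  · have hne : ∀ τ : G.Orientation, G.tail τ e ≠ v := fun τ hτ =>
      he ((mem_edgesAt τ).2 (.inl (Finset.mem_singleton.2 hτ)))
    exact iff_of_true (hne σ) (hne ρ)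

theorem IsSink.head_eq (hσ : G.IsSink σ v) (he : e ∈ G.edgesAt {v}) : G.head σ e = v := by
  simpa [mem_edgesAt σ, hσ e] using he

theorem IsSink.eq_of_mem_edgesAt (hσ : G.IsSink σ v) (hρ : G.IsSink ρ v)
    (he : e ∈ G.edgesAt {v}) : σ e = ρ e := by
  by_contra hne
  exact hρ e ((head_eq_tail_of_ne hne).symm.trans (hσ.head_eq he))

theorem IsSink.not_isSink_of_mem_neighbors (hv : G.IsSink σ v) (hu : u ∈ G.neighbors v) :
    ¬ G.IsSink σ u := by
  obtain ⟨e, ⟨he, -⟩ | ⟨-, he⟩⟩ := (mem_neighbors σ).1 hu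
  · exact absurd he (hv e)
  · exact fun hsink => hsink e he

theorem IsSink.card_edgesAt (hσ : G.IsSink σ v) : (G.edgesAt {v}).card = G.degree v := by
  rw [degree, ← Finset.card_union_of_disjoint, ← Finset.filter_or]
  · simp [edgesAt]
  · rw [Finset.disjoint_filter]
    intro e _ hfst hsnd
    exact hσ e (by rw [tail, hfst, hsnd, ite_self])

theorem isSink_piecewise_of_mem (hv : v ∈ J) :
    G.IsSink ((G.edgesAt J).piecewise ρ σ) v ↔ G.IsSink ρ v := by
  refine isSink_congr fun e he => Finset.piecewise_eq_of_mem _ _ _ ?_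
  have hsub : ∀ w ∈ ({v} : Finset (Fin n)), w ∈ J := by simpa using hv
  exact (mem_edgesAt ρ).2 (((mem_edgesAt ρ).1 he).imp (hsub _) (hsub _))

theorem isSink_piecewise_of_notMem (hu : u ∉ G.closedNeighbors J) :
    G.IsSink ((G.edgesAt J).piecewise ρ σ) u ↔ G.IsSink σ u := by
  refine isSink_congr fun e he => Finset.piecewise_eq_of_notMem _ _ _ fun heJ => hu ?_
  rw [closedNeighbors, Finset.mem_union, Finset.mem_biUnion]
  rw [mem_edgesAt σ, Finset.mem_singleton, Finset.mem_singleton] at he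
  rw [mem_edgesAt σ] at heJ
  obtain rfl | rfl := he
  · exact heJ.imp id fun h => ⟨_, h, (mem_neighbors σ).2 ⟨e, .inr ⟨rfl, rfl⟩⟩⟩
  · exact heJ.symm.imp id fun h => ⟨_, h, (mem_neighbors σ).2 ⟨e, .inl ⟨rfl, rfl⟩⟩⟩

open Classical in
theorem IsSink.two_pow_degree_mul_card (hσ : G.IsSink σ v) :
    2 ^ G.degree v * (Finset.univ.filter fun ρ : G.Orientation => G.IsSink ρ v).card = 2 ^ m := by
  have hfilter : (Finset.univ.filter fun ρ : G.Orientation => G.IsSink ρ v) =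
      Finset.univ.filter fun ρ : G.Orientation => ∀ e ∈ G.edgesAt {v}, ρ e = σ e := by
    ext ρ
    simp only [Finset.mem_filter, Finset.mem_univ, true_and]
    exact ⟨fun hρ e he => hρ.eq_of_mem_edgesAt hσ he, fun h => (isSink_congr h).2 hσ⟩
  have hcount := two_pow_card_mul_card_filter_forall_eq (G.edgesAt {v}) σ
  rw [Fintype.card_fin] at hcount
  rw [← hσ.card_edgesAt, hfilter]
  convert hcount

theorem two_pow_degree_mul_card_le (hv : v ∉ S) :
    2 ^ G.degree v * (G.sinkFreeOnWithSink S v).card ≤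
      (G.sinkFreeOn (S \ G.neighbors v)).card := by
  classical
  obtain hempty | ⟨σ, hσ⟩ := (G.sinkFreeOnWithSink S v).eq_empty_or_nonempty
  · simp [hempty]
  rw [mem_sinkFreeOnWithSink] at hσ
  set A := Finset.univ.filter fun ρ : G.Orientation => G.IsSink ρ v
  have hcard : ((G.sinkFreeOnWithSink S v) ×ˢ (Finset.univ : Finset G.Orientation)).card ≤
      (G.sinkFreeOn (S \ G.neighbors v) ×ˢ A).card := by
    refine Finset.card_le_card_of_injOn (fun p => ((G.edgesAt {v}).piecewise p.2 p.1,
      (G.edgesAt {v}).piecewise p.1 p.2)) ?_ (piecewise_swap_involutive _).injective.injOn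
    rintro ⟨σ, ρ⟩ h
    obtain ⟨hσ, hσv⟩ := mem_sinkFreeOnWithSink.1 (Finset.mem_product.1 h).1
    refine Finset.mem_product.2 ⟨mem_sinkFreeOn.2 fun u hu => ?_, ?_⟩
    · obtain ⟨huS, huv⟩ := Finset.mem_sdiff.1 hu
      rw [isSink_piecewise_of_notMem]
      · exact mem_sinkFreeOn.1 hσ u huS
      · simpa [closedNeighbors, huv] using ne_of_mem_of_not_mem huS hv
    · simpa [A, isSink_piecewise_of_mem] using hσv
  rw [Finset.card_product, Finset.card_product, Finset.card_univ, Fintype.card_pi_const,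
    Fintype.card_bool, ← hσ.2.two_pow_degree_mul_card, mul_left_comm, ← mul_assoc] at hcard
  exact Nat.le_of_mul_le_mul_right hcard (Finset.card_pos.2 ⟨σ, by simp [hσ.2]⟩)

theorem card_sinkFreeOn_insert (S : Finset (Fin n)) (v : Fin n) :
    (G.sinkFreeOn (insert v S)).card + (G.sinkFreeOnWithSink S v).card =
      (G.sinkFreeOn S).card := by
  classical
  rw [← Finset.card_filter_add_card_filter_not (s := G.sinkFreeOn S) (fun σ => ¬ G.IsSink σ v)]
  congr 2 <;> ext σ <;> simp [mem_sinkFreeOn, mem_sinkFreeOnWithSink, and_comm]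

theorem card_sinkFreeOn_insert_ge (h : 5 * ((G.sinkFreeOnWithSink S v).card : ℝ) ≤
    (G.sinkFreeOn S).card) :
    4 / 5 * ((G.sinkFreeOn S).card : ℝ) ≤ (G.sinkFreeOn (insert v S)).card := by
  have hcard := congrArg (Nat.cast (R := ℝ)) (card_sinkFreeOn_insert (G := G) S v)
  push_cast at hcard
  linarith

theorem mul_card_sinkFreeOnWithSink_le_of_neighbor
    (h : (4 / 5 : ℝ) ^ (S ∩ G.neighbors v).card * 2 ^ G.degree v *
      (G.sinkFreeOnWithSink S v).card ≤ (G.sinkFreeOn S).card)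
    (huv : u ∈ G.neighbors v) (hu : u ∉ S) :
    2 * (8 / 5 : ℝ) ^ (G.degree v - 1) * (G.sinkFreeOnWithSink S v).card ≤
      (G.sinkFreeOn S).card := by
  have hlt := card_inter_neighbors_lt huv hu
  refine le_trans (mul_le_mul_of_nonneg_right ?_ (Nat.cast_nonneg _)) h
  calc 2 * (8 / 5 : ℝ) ^ (G.degree v - 1)
      ≤ 2 * ((4 / 5 : ℝ) ^ (S ∩ G.neighbors v).card * 2 ^ (G.degree v - 1)) := by
        gcongr 2 * ?_
        exact eight_fifths_pow_le (Nat.le_sub_one_of_lt hlt)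
    _ = (4 / 5 : ℝ) ^ (S ∩ G.neighbors v).card * 2 ^ G.degree v := by
        rw [mul_left_comm, mul_pow_sub_one (by omega)]

theorem mul_card_sinkFreeOnWithSink_le (hG : ∀ v, 3 ≤ G.degree v) (S : Finset (Fin n))
    (hv : v ∉ S) :
    (4 / 5 : ℝ) ^ (S ∩ G.neighbors v).card * 2 ^ G.degree v * (G.sinkFreeOnWithSink S v).card ≤
      (G.sinkFreeOn S).card := by
  induction S using Finset.strongInduction generalizing v with
  | H S ih =>
    have hinsert : ∀ T ⊆ S \ G.neighbors v ∪ S ∩ G.neighbors v, ∀ u ∈ S ∩ G.neighbors v, u ∉ T →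
        4 / 5 * ((G.sinkFreeOn T).card : ℝ) ≤ (G.sinkFreeOn (insert u T)).card := by
      intro T hT u hu huT
      rw [Finset.sdiff_union_inter] at hT
      obtain ⟨huS, huv⟩ := Finset.mem_inter.1 hu
      have hTS : T ⊂ S := (Finset.ssubset_iff_of_subset hT).2 ⟨u, huS, huT⟩
      have hpow : (8 / 5 : ℝ) ^ 2 ≤ (8 / 5) ^ (G.degree u - 1) :=
        pow_le_pow_right₀ (by norm_num) (Nat.le_sub_one_of_lt (hG u))
      refine card_sinkFreeOn_insert_ge (le_trans (mul_le_mul_of_nonneg_right ?_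
        (Nat.cast_nonneg _)) (mul_card_sinkFreeOnWithSink_le_of_neighbor (ih T hTS huT)
          (neighbors_symm huv) fun hvT => hv (hT hvT)))
      linarith
    calc (4 / 5 : ℝ) ^ (S ∩ G.neighbors v).card * 2 ^ G.degree v *
          (G.sinkFreeOnWithSink S v).card
        ≤ (4 / 5) ^ (S ∩ G.neighbors v).card * (G.sinkFreeOn (S \ G.neighbors v)).card := by
          rw [mul_assoc]
          gcongr
          exact_mod_cast two_pow_degree_mul_card_le hv
      _ ≤ (G.sinkFreeOn (S \ G.neighbors v ∪ S ∩ G.neighbors v)).card :=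
          pow_card_mul_le_of_forall_insert (f := fun S => ((G.sinkFreeOn S).card : ℝ))
            (by norm_num) (Finset.disjoint_sdiff_inter _ _) hinsert
      _ = (G.sinkFreeOn S).card := by rw [Finset.sdiff_union_inter]

theorem sinkFreeOn_nonempty (hG : ∀ v, 3 ≤ G.degree v) (S : Finset (Fin n)) :
    (G.sinkFreeOn S).Nonempty := by
  induction S using Finset.induction_on with
  | empty => exact ⟨fun _ => true, by simp [mem_sinkFreeOn]⟩
  | insert v S hv ih =>
    have hpow : 1 < (4 / 5 : ℝ) ^ (S ∩ G.neighbors v).card * 2 ^ G.degree v :=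
      (one_lt_pow₀ (by norm_num) (by have := hG v; omega)).trans_le <| eight_fifths_pow_le <|
        (Finset.card_le_card Finset.inter_subset_right).trans (card_neighbors_le v)
    have hle := mul_card_sinkFreeOnWithSink_le hG S hv
    have hpos : (0 : ℝ) < (G.sinkFreeOn S).card := by exact_mod_cast ih.card_pos
    have hlt : (G.sinkFreeOnWithSink S v).card < (G.sinkFreeOn S).card := by
      by_contra! hge
      have hge' : ((G.sinkFreeOn S).card : ℝ) ≤ (G.sinkFreeOnWithSink S v).card := by
        exact_mod_cast hge
      nlinarith
    have hcard := card_sinkFreeOn_insert (G := G) S v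
    exact Finset.card_pos.1 (by omega)

/-- Every vertex outside `S` has a neighbour outside `S`. -/
def OpenEnded (G : EdgeListGraph n m) (S : Finset (Fin n)) : Prop :=
  ∀ v ∉ S, ∃ u ∈ G.neighbors v, u ∉ S

theorem OpenEnded.succ_degree_mul_card_le (hG : ∀ v, 3 ≤ G.degree v) (hS : G.OpenEnded S)
    (hv : v ∉ S) :
    ((G.degree v : ℝ) + 1) * (G.sinkFreeOnWithSink S v).card ≤
      25 / 32 * (G.sinkFreeOn S).card := by
  obtain ⟨u, huv, hu⟩ := hS v hv
  have hle := mul_card_sinkFreeOnWithSink_le_of_neighbor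
    (mul_card_sinkFreeOnWithSink_le hG S hv) huv hu
  obtain ⟨d, hd⟩ := Nat.exists_eq_add_of_le' (hG v)
  calc ((G.degree v : ℝ) + 1) * (G.sinkFreeOnWithSink S v).card
      ≤ 25 / 16 * (8 / 5) ^ (G.degree v - 1) * (G.sinkFreeOnWithSink S v).card := by
        gcongr
        rw [hd]
        push_cast
        linarith [add_four_le_mul_pow d]
    _ ≤ 25 / 32 * (G.sinkFreeOn S).card := by linarith

theorem card_closedNeighbors_le (J : Finset (Fin n)) :
    (G.closedNeighbors J).card ≤ ∑ v ∈ J, (G.degree v + 1) := by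
  rw [Finset.sum_add_distrib, Finset.sum_const, smul_eq_mul, mul_one, add_comm]
  exact (Finset.card_union_le _ _).trans <| add_le_add_right
    (Finset.card_biUnion_le.trans (Finset.sum_le_sum fun v _ => card_neighbors_le v)) _

theorem OpenEnded.sum_card_closedNeighbors_le (hG : ∀ v, 3 ≤ G.degree v) (hS : G.OpenEnded S) :
    ∑ σ ∈ G.sinkFreeOn S, ((G.closedNeighbors (G.sinks σ)).card : ℝ) ≤
      25 / 32 * Sᶜ.card * (G.sinkFreeOn S).card := by
  classical
  have hsinks : ∀ σ ∈ G.sinkFreeOn S, G.sinks σ = Sᶜ.filter fun v => G.IsSink σ v := by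
    intro σ hσ
    ext v
    simpa [mem_sinks] using fun h hv => mem_sinkFreeOn.1 hσ v hv h
  calc ∑ σ ∈ G.sinkFreeOn S, ((G.closedNeighbors (G.sinks σ)).card : ℝ)
      ≤ ∑ σ ∈ G.sinkFreeOn S, ∑ v ∈ Sᶜ, if G.IsSink σ v then (G.degree v : ℝ) + 1 else 0 := by
        refine Finset.sum_le_sum fun σ hσ => ?_
        rw [← Finset.sum_filter, ← hsinks σ hσ]
        exact_mod_cast card_closedNeighbors_le (G.sinks σ)
    _ = ∑ v ∈ Sᶜ, ((G.degree v : ℝ) + 1) * (G.sinkFreeOnWithSink S v).card := by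
        rw [Finset.sum_comm]
        refine Finset.sum_congr rfl fun v _ => ?_
        rw [← Finset.sum_filter, Finset.sum_const, nsmul_eq_mul, mul_comm, sinkFreeOnWithSink]
    _ ≤ ∑ v ∈ Sᶜ, 25 / 32 * ((G.sinkFreeOn S).card : ℝ) :=
        Finset.sum_le_sum fun v hv => hS.succ_degree_mul_card_le hG (Finset.mem_compl.1 hv)
    _ = 25 / 32 * Sᶜ.card * (G.sinkFreeOn S).card := by
        rw [Finset.sum_const, nsmul_eq_mul]
        ring

theorem neighbors_nonempty (hv : 0 < G.degree v) : (G.neighbors v).Nonempty := by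
  contrapose! hv
  rw [neighbors, Finset.union_eq_empty, Finset.image_eq_empty, Finset.image_eq_empty] at hv
  rw [degree, hv.1, hv.2, Finset.card_empty]

theorem openEnded_empty (hG : ∀ v, 0 < G.degree v) : G.OpenEnded ∅ := fun v _ =>
  (neighbors_nonempty (hG v)).imp fun _ hu => ⟨hu, Finset.notMem_empty _⟩

theorem openEnded_compl_closedNeighbors (hG : ∀ v, 0 < G.degree v) (J : Finset (Fin n)) :
    G.OpenEnded (G.closedNeighbors J)ᶜ := by
  intro v hv
  simp only [Finset.mem_compl, not_not, closedNeighbors, Finset.mem_union,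
    Finset.mem_biUnion] at hv ⊢
  obtain hvJ | ⟨w, hw, hvw⟩ := hv
  · exact (neighbors_nonempty (hG v)).imp fun u hu => ⟨hu, .inr ⟨v, hvJ, hu⟩⟩
  · exact ⟨w, neighbors_symm hvw, .inl hw⟩

end EdgeListGraph

/-! ## Mixing of sink popping -/

namespace EdgeListGraph

variable {n m : ℕ} {G : EdgeListGraph n m} {S J : Finset (Fin n)} {σ : G.Orientation}

theorem sinkEdges_eq (σ : G.Orientation) : G.sinkEdges σ = G.edgesAt (G.sinks σ) := by
  ext e
  have htail : ¬ G.IsSink σ (G.tail σ e) := fun h => h e rfl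
  simp [sinkEdges, mem_edgesAt σ, mem_sinks, htail]

theorem sinks_piecewise_eq {ρ : G.Orientation}
    (hσ : σ ∈ G.sinkFreeOn (G.closedNeighbors J)ᶜ) (hρ : J ⊆ G.sinks ρ) :
    G.sinks ((G.edgesAt J).piecewise ρ σ) = J := by
  have hJ : ∀ v ∈ J, G.IsSink ((G.edgesAt J).piecewise ρ σ) v := fun v hv =>
    (isSink_piecewise_of_mem hv).2 (mem_sinks.1 (hρ hv))
  ext v
  refine mem_sinks.trans ⟨fun hsink => ?_, hJ v⟩
  by_cases hv : v ∈ G.closedNeighbors J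
  · refine (Finset.mem_union.1 hv).resolve_right fun hneighbor => ?_
    obtain ⟨w, hw, hvw⟩ := Finset.mem_biUnion.1 hneighbor
    exact (hJ w hw).not_isSink_of_mem_neighbors hvw hsink
  · exact absurd ((isSink_piecewise_of_notMem hv).1 hsink)
      (mem_sinkFreeOn.1 hσ v (Finset.mem_compl.2 hv))

theorem piecewise_mem_sinkFreeOn {ρ : G.Orientation} (hσ : G.sinks σ = J) :
    (G.edgesAt J).piecewise ρ σ ∈ G.sinkFreeOn (G.closedNeighbors J)ᶜ := by
  refine mem_sinkFreeOn.2 fun u hu hsink => ?_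
  rw [Finset.mem_compl] at hu
  rw [isSink_piecewise_of_notMem hu, ← mem_sinks, hσ] at hsink
  exact hu (Finset.mem_union_left _ hsink)

theorem subset_sinks_piecewise {ρ : G.Orientation} (hρ : J ⊆ G.sinks ρ) :
    J ⊆ G.sinks ((G.edgesAt J).piecewise ρ σ) := fun _ hv =>
  mem_sinks.2 ((isSink_piecewise_of_mem hv).2 (mem_sinks.1 (hρ hv)))

theorem uniformOfFinset_sinks_eq_bind_popSinks
    (hJ : (Finset.univ.filter fun σ : G.Orientation => G.sinks σ = J).Nonempty)
    (hne : (G.sinkFreeOn (G.closedNeighbors J)ᶜ).Nonempty) :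
    (PMF.uniformOfFinset _ hJ).bind G.popSinks = PMF.uniformOfFinset _ hne := by
  have hpop : (PMF.uniformOfFinset _ hJ).bind G.popSinks =
      (PMF.uniformOfFinset _ hJ).bind (resample (G.edgesAt J)) :=
    uniformOfFinset_bind_congr hJ fun σ hσ => by
      rw [popSinks, sinkEdges_eq, (Finset.mem_filter.1 hσ).2]
  have hinv := piecewise_swap_involutive (β := Bool) (G.edgesAt J)
  rw [hpop]
  refine uniformOfFinset_bind_map_of_bijOn (D := Finset.univ.filter fun ρ => J ⊆ G.sinks ρ)
    hJ Finset.univ_nonempty hne (f := fun σ ρ => (G.edgesAt J).piecewise ρ σ)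
    (g := fun σ ρ => (G.edgesAt J).piecewise σ ρ)
    (Set.InvOn.bijOn ⟨fun p _ => hinv p, fun p _ => hinv p⟩ ?_ ?_)
  · rintro ⟨σ, ρ⟩ h
    have hσ : G.sinks σ = J := by simpa using h
    simpa [piecewise_mem_sinkFreeOn hσ] using subset_sinks_piecewise hσ.ge
  · rintro ⟨σ, ρ⟩ h
    obtain ⟨hσ, hρ⟩ : σ ∈ G.sinkFreeOn (G.closedNeighbors J)ᶜ ∧ J ⊆ G.sinks ρ := by simpa using h
    simpa using sinks_piecewise_eq hσ hρ

theorem filter_sinks_eq (hσ : σ ∈ G.sinkFreeOn S) :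
    ((G.sinkFreeOn S).filter fun ρ => G.sinks ρ = G.sinks σ) =
      Finset.univ.filter fun ρ => G.sinks ρ = G.sinks σ := by
  ext ρ
  simp only [Finset.mem_filter, Finset.mem_univ, true_and, and_iff_right_iff_imp]
  intro h
  refine mem_sinkFreeOn.2 fun v hv => ?_
  rw [← mem_sinks, h, mem_sinks]
  exact mem_sinkFreeOn.1 hσ v hv

theorem uniformOfFinset_bind_popSinks (hG : ∀ S, (G.sinkFreeOn S).Nonempty)
    (S : Finset (Fin n)) :
    (PMF.uniformOfFinset _ (hG S)).bind G.popSinks =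
      (PMF.uniformOfFinset _ (hG S)).bind fun σ =>
        PMF.uniformOfFinset _ (hG (G.closedNeighbors (G.sinks σ))ᶜ) := by
  refine uniformOfFinset_bind_congr_fiberwise _ G.sinks fun J hJ => ?_
  obtain ⟨σ, hσ⟩ := hJ
  obtain ⟨hσS, rfl⟩ := Finset.mem_filter.1 hσ
  simp only [filter_sinks_eq hσS]
  rw [uniformOfFinset_sinks_eq_bind_popSinks _ (hG _)]
  refine (PMF.bind_const _ _).symm.trans (uniformOfFinset_bind_congr _ fun ρ hρ => ?_)
  simp only [(Finset.mem_filter.1 hρ).2]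

theorem uniformOfFinset_bind_iteratePopSinks_succ (hG : ∀ S, (G.sinkFreeOn S).Nonempty)
    (S : Finset (Fin n)) (R : ℕ) :
    (PMF.uniformOfFinset _ (hG S)).bind (G.iteratePopSinks (R + 1)) =
      (PMF.uniformOfFinset _ (hG S)).bind fun σ =>
        (PMF.uniformOfFinset _ (hG (G.closedNeighbors (G.sinks σ))ᶜ)).bind
          (G.iteratePopSinks R) := by
  rw [← PMF.bind_bind, ← uniformOfFinset_bind_popSinks, PMF.bind_bind]
  rfl

theorem sinkFreeOn_univ : G.sinkFreeOn Finset.univ = G.sinkFree := by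
  ext σ
  simp [mem_sinkFreeOn, sinkFree]

theorem OpenEnded.tvDist_iteratePopSinks_le (hG : ∀ v, 3 ≤ G.degree v) (hS : G.OpenEnded S)
    (hΩ : G.sinkFree.Nonempty) (R : ℕ) :
    tvDist ((PMF.uniformOfFinset _ (sinkFreeOn_nonempty hG S)).bind (G.iteratePopSinks R))
      (PMF.uniformOfFinset _ hΩ) ≤ (25 / 32) ^ R * Sᶜ.card := by
  induction R generalizing S with
  | zero =>
    rw [show G.iteratePopSinks 0 = PMF.pure from rfl, PMF.bind_pure, pow_zero, one_mul]
    obtain hempty | hne := Sᶜ.eq_empty_or_nonempty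
    · obtain rfl := (Finset.compl_eq_empty_iff S).1 hempty
      simp only [sinkFreeOn_univ, tvDist_self, Nat.cast_nonneg]
    · exact (tvDist_le_one _ _).trans (by exact_mod_cast hne.card_pos)
  | succ R ih =>
    have hcard : (0 : ℝ) < (G.sinkFreeOn S).card := by
      exact_mod_cast (sinkFreeOn_nonempty hG S).card_pos
    have hmix (σ : G.Orientation) := ih (openEnded_compl_closedNeighbors
      (fun v => three_pos.trans_le (hG v)) (G.sinks σ))
    simp only [compl_compl] at hmix
    rw [uniformOfFinset_bind_iteratePopSinks_succ (sinkFreeOn_nonempty hG)]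
    calc _ ≤ (∑ σ ∈ G.sinkFreeOn S, (25 / 32 : ℝ) ^ R * (G.closedNeighbors (G.sinks σ)).card) /
            (G.sinkFreeOn S).card := by
          refine (tvDist_uniformOfFinset_bind_le _ _ _).trans ?_
          gcongr with σ
          exact hmix σ
      _ ≤ (25 / 32 : ℝ) ^ R * (25 / 32 * Sᶜ.card * (G.sinkFreeOn S).card) /
            (G.sinkFreeOn S).card := by
          rw [← Finset.mul_sum]
          gcongr
          exact hS.sum_card_closedNeighbors_le hG
      _ = (25 / 32) ^ (R + 1) * Sᶜ.card := by
          rw [← mul_assoc, mul_div_cancel_right₀ _ hcard.ne']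
          ring

theorem tvDist_uniform_bind_iteratePopSinks_le (hG : ∀ v, 3 ≤ G.degree v)
    (hΩ : G.sinkFree.Nonempty) (R : ℕ) :
    tvDist ((PMF.uniformOfFintype G.Orientation).bind (G.iteratePopSinks R))
      (PMF.uniformOfFinset _ hΩ) ≤ (25 / 32) ^ R * n := by
  have hempty : G.sinkFreeOn ∅ = Finset.univ := by
    simp [sinkFreeOn]
  have h := (openEnded_empty fun v =>
    three_pos.trans_le (hG v)).tvDist_iteratePopSinks_le hG hΩ R
  simp only [hempty, Finset.compl_empty, Finset.card_univ, Fintype.card_fin] at h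
  exact h

end EdgeListGraph

/-! ## A program logic for the machine -/

namespace RAM

theorem run_succ (t : ℕ) (c : Config) : run (t + 1) c = (step c).bind (run t) := rfl

theorem run_halted (t : ℕ) (s : Store) : run t ([], s) = PMF.pure ([], s) := by
  induction t with
  | zero => rfl
  | succ t ih => rw [run_succ, step, PMF.pure_bind, ih]

/-- `Reaches Q T c μ` says that, whatever the outcomes of the coin tosses, the machine gets from `c`
in at most `T` steps to a configuration `c'` with `Q b c'`, where the value `b`, which may depend on
the outcomes, has the law `μ`. -/
inductive Reaches {β : Type} (Q : β → Config → Prop) : ℕ → Config → PMF β → Prop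
  | refl {T : ℕ} {c : Config} {b : β} (h : Q b c) : Reaches Q T c (PMF.pure b)
  | head {T : ℕ} {c : Config} {γ : Type} {κ : PMF γ} {next : γ → Config} {ν : γ → PMF β}
      (hstep : step c = κ.map next) (h : ∀ x ∈ κ.support, Reaches Q T (next x) (ν x)) :
      Reaches Q (T + 1) c (κ.bind ν)

variable {β γ : Type} {Q : β → Config → Prop} {R : γ → Config → Prop} {T U : ℕ} {c : Config}
  {μ : PMF β} {ν : β → PMF γ}

theorem Reaches.mono {Q' : β → Config → Prop} (h : Reaches Q T c μ) (hTU : T ≤ U)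
    (hQ : ∀ b c', Q b c' → Q' b c') : Reaches Q' U c μ := by
  induction h generalizing U with
  | refl h => exact .refl (hQ _ _ h)
  | head hstep _ ih =>
    obtain ⟨U, rfl⟩ : ∃ V, U = V + 1 := ⟨U - 1, by omega⟩
    exact .head hstep fun x hx => ih x hx (by omega)

theorem Reaches.bind (h : Reaches Q T c μ) (hR : ∀ b c', Q b c' → Reaches R U c' (ν b)) :
    Reaches R (T + U) c (μ.bind ν) := by
  induction h with
  | refl h => exact PMF.pure_bind _ ν ▸ (hR _ _ h).mono (Nat.le_add_left _ _) fun _ _ => id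
  | head hstep _ ih =>
    rw [PMF.bind_bind, Nat.add_right_comm]
    exact .head hstep ih

theorem Reaches.of_step {c' : Config} (hstep : step c = PMF.pure c') (h : Reaches Q T c' μ) :
    Reaches Q (T + 1) c μ := by
  have hhead := Reaches.head (κ := PMF.pure c') (next := id) (ν := fun _ => μ)
    (by rw [hstep, PMF.map_id]) fun x hx => (PMF.mem_support_pure_iff _ _).1 hx ▸ h
  rwa [PMF.bind_const] at hhead

theorem Reaches.of_run {b : β} (h : ∀ c' ∈ (RAM.run T c).support, Q b c') :
    Reaches Q T c (PMF.pure b) := by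
  induction T generalizing c with
  | zero => exact .refl (h c ((PMF.mem_support_pure_iff _ _).2 rfl))
  | succ T ih =>
    have hhead := Reaches.head (next := id) (ν := fun _ => PMF.pure b) (PMF.map_id (step c)).symm
      fun x hx => ih (c := x) fun c' hc' => h c' ((PMF.mem_support_bind_iff _ _ _).2 ⟨x, hx, hc'⟩)
    rwa [PMF.bind_const] at hhead

theorem Reaches.run {o : Config → β} (h : Reaches Q T c μ)
    (hQ : ∀ b c', Q b c' → Halted c' ∧ o c' = b) :
    (∀ c' ∈ (run T c).support, Halted c') ∧ (run T c).map o = μ := by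
  induction h with
  | @refl T c b h =>
    obtain ⟨k, s⟩ := c
    obtain ⟨rfl : k = [], ho⟩ := hQ _ _ h
    rw [run_halted]
    refine ⟨fun c' hc' => ?_, by rw [PMF.pure_map, ho]⟩
    rw [PMF.support_pure, Set.mem_singleton_iff] at hc'
    exact hc' ▸ rfl
  | @head T c γ κ next ν hstep _ ih =>
    rw [run_succ, hstep, PMF.bind_map, PMF.map_bind]
    constructor
    · intro c' hc'
      obtain ⟨x, hx, hc'⟩ := (PMF.mem_support_bind_iff _ _ _).1 hc'
      exact (ih x hx).1 _ hc'
    · ext b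
      rw [PMF.bind_apply, PMF.bind_apply]
      refine tsum_congr fun x => ?_
      by_cases hx : x ∈ κ.support
      · rw [← (ih x hx).2]; rfl
      · rw [(PMF.apply_eq_zero_iff _ _).2 hx, zero_mul, zero_mul]

/-- `Executes p T s μ Q` says that `p`, started in the memory `s`, terminates within `T` steps, in a
memory `s'` with `Q b s'` for a random value `b` of law `μ`. -/
def Executes (p : Program) (T : ℕ) (s : Store) (μ : PMF β) (Q : β → Store → Prop) : Prop :=
  ∀ k, Reaches (fun b c => ∃ s', Q b s' ∧ c = (k, s')) T (p :: k, s) μ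

variable {t : Test} {p q : Program} {s s' : Store}

theorem Executes.run {o : Config → β} {Q : β → Store → Prop} (h : Executes p T s μ Q)
    (hQ : ∀ b s', Q b s' → o ([], s') = b) :
    (∀ c ∈ (run T ([p], s)).support, Halted c) ∧ (run T ([p], s)).map o = μ :=
  (h []).run fun b _ ⟨s', hs', hc⟩ => hc ▸ ⟨rfl, hQ b s' hs'⟩

theorem Executes.mono {P P' : β → Store → Prop} (h : Executes p T s μ P) (hTU : T ≤ U)
    (hP : ∀ b s', P b s' → P' b s') : Executes p U s μ P' :=
  fun k => (h k).mono hTU fun _ _ ⟨s', hs', hc⟩ => ⟨s', hP _ _ hs', hc⟩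

theorem Executes.seq {P : β → Store → Prop} {P' : γ → Store → Prop} (hp : Executes p T s μ P)
    (hq : ∀ b s', P b s' → Executes q U s' (ν b) P') :
    Executes (.seq p q) (T + U + 1) s (μ.bind ν) P' :=
  fun k => .of_step (by rw [step]) <| (hp (q :: k)).bind fun b _ ⟨_, hP, hc⟩ => hc ▸ hq b _ hP k

theorem Executes.ite {P : β → Store → Prop}
    (h : Executes (if t.eval s then p else q) T s μ P) : Executes (.ite t p q) (T + 1) s μ P :=
  fun k => .of_step (by rw [step]) (h k)

theorem executes_flip (x : ℕ) (s : Store) :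
    Executes (.flip x) 1 s (PMF.uniformOfFintype Bool) fun b s' => s' = s.setReg x b.toNat := by
  intro k
  have hhead := Reaches.head (Q := fun (b : Bool) c => ∃ s', s' = s.setReg x b.toNat ∧ c = (k, s'))
    (T := 0) (ν := PMF.pure) (show step (.flip x :: k, s) = _ by rw [step])
    fun b _ => .refl ⟨_, rfl, rfl⟩
  rwa [PMF.bind_pure] at hhead

theorem executes_while {P : ℕ → β → Store → Prop} {L : ℕ → β → PMF β}
    (hzero : ∀ b s, P 0 b s → t.eval s = false ∧ L 0 b = PMF.pure b)
    (hsucc : ∀ j b s, P (j + 1) b s → t.eval s = true ∧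
      ∃ μ, Executes p T s μ (P j) ∧ L (j + 1) b = μ.bind (L j))
    {j : ℕ} {b : β} (hP : P j b s) :
    Executes (.while t p) ((T + 1) * j + 1) s (L j b) (P 0) := by
  induction j generalizing b s with
  | zero =>
    obtain ⟨ht, hL⟩ := hzero b s hP
    rw [hL]
    exact fun k => .of_step (by rw [step, ht]; rfl) (.refl ⟨s, hP, rfl⟩)
  | succ j ih =>
    obtain ⟨ht, μ, hp, hL⟩ := hsucc j b s hP
    intro k
    rw [hL, show (T + 1) * (j + 1) + 1 = T + ((T + 1) * j + 1) + 1 by ring]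
    exact .of_step (by rw [step, ht]; rfl) <|
      (hp (.while t p :: k)).bind fun b _ ⟨_, hP, hc⟩ => hc ▸ ih hP k

/-- `Computes p T s P` says that `p`, started in the memory `s`, terminates within `T` steps in a
memory that satisfies `P`. -/
def Computes (p : Program) (T : ℕ) (s : Store) (P : Store → Prop) : Prop :=
  Executes p T s (PMF.pure ()) fun _ => P

variable {P : Store → Prop}

theorem computes_of_run (h : ∀ k, run T (p :: k, s) = PMF.pure (k, s')) (hP : P s') :
    Computes p T s P :=
  fun k => .of_run fun c' hc' => by
    rw [h, PMF.mem_support_pure_iff] at hc'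
    exact ⟨s', hP, hc'⟩

theorem Computes.executes {P' : β → Store → Prop} (h : Computes p T s P) {b : β}
    (hP : ∀ s', P s' → P' b s') : Executes p T s (PMF.pure b) P' := by
  intro k
  have hbind : Reaches (fun b c => ∃ s', P' b s' ∧ c = (k, s')) (T + 0) (p :: k, s)
      ((PMF.pure ()).bind fun _ => PMF.pure b) :=
    (h k).bind fun _ _ ⟨s', hs', hc⟩ => .refl ⟨s', hP _ hs', hc⟩
  rwa [PMF.pure_bind] at hbind

theorem Computes.seq {P' : β → Store → Prop} (hp : Computes p T s P)
    (hq : ∀ s', P s' → Executes q U s' μ P') : Executes (.seq p q) (T + U + 1) s μ P' := by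
  have hseq := Executes.seq hp (ν := fun _ => μ) fun _ => hq
  rwa [PMF.pure_bind] at hseq

theorem Executes.seq_computes {P : β → Store → Prop} {P' : β → Store → Prop}
    (hp : Executes p T s μ P) (hq : ∀ b s', P b s' → Computes q U s' (P' b)) :
    Executes (.seq p q) (T + U + 1) s μ P' := by
  have hseq := hp.seq (ν := PMF.pure) fun b s' hP => (hq b s' hP).executes fun _ => id
  rwa [PMF.bind_pure] at hseq

theorem computes_while {P : ℕ → Store → Prop} (hzero : ∀ s, P 0 s → t.eval s = false)
    (hsucc : ∀ j s, P (j + 1) s → t.eval s = true ∧ Computes p T s (P j)) {j : ℕ} (hP : P j s) :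
    Computes (.while t p) ((T + 1) * j + 1) s (P 0) :=
  executes_while (P := fun j _ => P j) (L := fun _ => PMF.pure)
    (fun _ s h => ⟨hzero s h, rfl⟩)
    (fun j _ s h => ⟨(hsucc j s h).1, _, (hsucc j s h).2, (PMF.pure_bind _ _).symm⟩) hP

end RAM

/-! ## The program -/

namespace SinkPopping

open RAM EdgeListGraph

/-- Execute the programs of a list one after the other. -/
def block : List Program → Program
  | [] => .skip
  | [p] => p
  | p :: l => .seq p (block l)

/-- Register `5` becomes the endpoint, read off from array `i` or from array `j`, of the edge in
register `3`, according to whether the edge is directed from `snd` to `fst` or not. -/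
def loadEndpoint (i j : ℕ) : Program :=
  block [.load 4 3 3, .ite (.eq 4 2) (.load 5 i 3) (.load 5 j 3)]

/-- Orient the edge in register `3` at random. -/
def toss : Program := block [.flip 4, .store 3 3 4]

/-- Execute `p` for the values of register `3` from `0` up to, but excluding, the content of
register `x`. -/
def forEach (x : ℕ) (p : Program) : Program :=
  block [.const 3 0, .while (.lt 3 x) (block [p, .inc 3])]

/-- Unmark all vertices. A vertex `v` is marked when entry `v` of array `4` is nonzero. -/
def unmark : Program := forEach 0 (.store 4 3 2)

/-- Mark the tails of all edges. -/
def mark : Program := forEach 1 (block [loadEndpoint 1 0, .store 4 5 1])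

/-- Orient all edges with an unmarked head at random. -/
def resampleUnmarked : Program :=
  forEach 1 (block [loadEndpoint 0 1, .load 5 4 5, .ite (.eq 5 2) toss .skip])

/-- One round of sink popping. -/
def round : Program := block [.dec 6, unmark, mark, resampleUnmarked]

variable {n m r : ℕ} {G : EdgeListGraph n m} {σ : G.Orientation} {s : Store}

/-- The memory `s` holds the graph `G`, the orientation `σ` and the number `r` of rounds. -/
structure Holds (G : EdgeListGraph n m) (r : ℕ) (σ : G.Orientation) (s : Store) : Prop where
  vertices : s.reg 0 = n
  edges : s.reg 1 = m
  zero : s.reg 2 = 0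
  rounds : s.reg 6 = r
  fst (e : Fin m) : s.arr 0 e = G.fst e
  snd (e : Fin m) : s.arr 1 e = G.snd e
  orientation (e : Fin m) : s.arr 3 e = (σ e).toNat

namespace Holds

theorem setReg (hs : Holds G r σ s) {x : ℕ} (hx : 2 < x) (hx' : x ≠ 6) (a : ℕ) :
    Holds G r σ (s.setReg x a) where
  vertices := by simp [Store.setReg, hs.vertices, show 0 ≠ x by omega]
  edges := by simp [Store.setReg, hs.edges, show 1 ≠ x by omega]
  zero := by simp [Store.setReg, hs.zero, show 2 ≠ x by omega]
  rounds := by simp [Store.setReg, hs.rounds, hx'.symm]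
  fst := hs.fst
  snd := hs.snd
  orientation := hs.orientation

theorem setRounds (hs : Holds G r σ s) (r' : ℕ) : Holds G r' σ (s.setReg 6 r') where
  vertices := by simp [Store.setReg, hs.vertices]
  edges := by simp [Store.setReg, hs.edges]
  zero := by simp [Store.setReg, hs.zero]
  rounds := by simp [Store.setReg]
  fst := hs.fst
  snd := hs.snd
  orientation := hs.orientation

theorem setMark (hs : Holds G r σ s) (v a : ℕ) : Holds G r σ (s.setArr 4 v a) where
  vertices := hs.vertices
  edges := hs.edges
  zero := hs.zero
  rounds := hs.rounds
  fst := by simp [Store.setArr, hs.fst]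
  snd := by simp [Store.setArr, hs.snd]
  orientation := by simp [Store.setArr, hs.orientation]

theorem setOrientation (hs : Holds G r σ s) (e : Fin m) (b : Bool) :
    Holds G r (Function.update σ e b) (s.setArr 3 e b.toNat) where
  vertices := hs.vertices
  edges := hs.edges
  zero := hs.zero
  rounds := hs.rounds
  fst := by simp [Store.setArr, hs.fst]
  snd := by simp [Store.setArr, hs.snd]
  orientation e' := by
    obtain rfl | h := eq_or_ne e' e
    · simp [Store.setArr]
    · simp [Store.setArr, hs.orientation, h, Fin.val_ne_iff.2 h]

end Holds

theorem computes_loadTail (hs : Holds G r σ s) {e : Fin m} (he : s.reg 3 = e) :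
    Computes (loadEndpoint 1 0) 4 s
      (· = (s.setReg 4 (σ e).toNat).setReg 5 (G.tail σ e)) := by
  refine computes_of_run (fun k => ?_) rfl
  cases h : σ e <;> simp [loadEndpoint, block, run, step, Store.setReg, Test.eval, he,
    hs.orientation, hs.zero, hs.fst, hs.snd, h, tail]

theorem computes_loadHead (hs : Holds G r σ s) {e : Fin m} (he : s.reg 3 = e) :
    Computes (loadEndpoint 0 1) 4 s
      (· = (s.setReg 4 (σ e).toNat).setReg 5 (G.head σ e)) := by
  refine computes_of_run (fun k => ?_) rfl
  cases h : σ e <;> simp [loadEndpoint, block, run, step, Store.setReg, Test.eval, he,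
    hs.orientation, hs.zero, hs.fst, hs.snd, h, head]

theorem executes_forEach {β : Type} {x N T : ℕ} {p : Program} {P : ℕ → β → Store → Prop}
    {L : ℕ → β → PMF β} (hx : ∀ i b s, P i b s → s.reg x = N) (hL : ∀ b, L N b = PMF.pure b)
    (hbody : ∀ i < N, ∀ b s, P i b s → s.reg 3 = i → ∃ μ,
      Executes p T s μ (fun b' s' => P (i + 1) b' (s'.setReg 3 (i + 1)) ∧ s'.reg 3 = i) ∧
      L i b = μ.bind (L (i + 1)))
    {b : β} (hP : P 0 b (s.setReg 3 0)) :
    Executes (forEach x p) ((T + 3) * N + 3) s (L 0 b) (P N) := by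
  have hloop : Executes (.while (.lt 3 x) (block [p, .inc 3])) ((T + 3) * N + 1)
      (s.setReg 3 0) (L (N - N) b)
      fun b s => P (N - 0) b s ∧ s.reg 3 + 0 = N := by
    refine executes_while (P := fun j b s => P (N - j) b s ∧ s.reg 3 + j = N)
      (L := fun j => L (N - j)) (fun b s ⟨hP, h3⟩ => ⟨?_, hL b⟩)
      (fun j b s ⟨hP, h3⟩ => ⟨?_, ?_⟩) ⟨by rwa [Nat.sub_self], by simp [Store.setReg]⟩
    · simp [Test.eval, hx _ _ _ hP, ← h3]
    · simp [Test.eval, hx _ _ _ hP, ← h3]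
    · have hj : N - j = N - (j + 1) + 1 := by omega
      obtain ⟨μ, hp, hμ⟩ := hbody (N - (j + 1)) (by omega) b s hP (by omega)
      refine ⟨μ, hp.seq_computes fun b' s' ⟨hP', h3'⟩ => ?_, by rw [hμ, hj]⟩
      refine computes_of_run (T := 1) (s' := s'.setReg 3 (N - (j + 1) + 1))
        (fun k => by simp [block, run, step, h3']) ⟨hj ▸ hP', ?_⟩
      simp [Store.setReg]
      omega
  have hconst : Computes (.const 3 0) 1 s (· = s.setReg 3 0) :=
    computes_of_run (fun k => by simp [run, step]) rfl
  rw [Nat.sub_self] at hloop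
  have hseq := hconst.seq fun s' hs' => hs' ▸ hloop
  exact hseq.mono (by omega) fun b s h => h.1

theorem computes_forEach {x N T : ℕ} {p : Program} {P : ℕ → Store → Prop}
    (hx : ∀ i s, P i s → s.reg x = N)
    (hbody : ∀ i < N, ∀ s, P i s → s.reg 3 = i →
      Computes p T s (fun s' => P (i + 1) (s'.setReg 3 (i + 1)) ∧ s'.reg 3 = i))
    (hP : P 0 (s.setReg 3 0)) : Computes (forEach x p) ((T + 3) * N + 3) s (P N) :=
  executes_forEach (L := fun _ => PMF.pure) (P := fun i _ => P i) (fun i _ => hx i) (fun _ => rfl)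
    (fun i hi _ s hs h3 => ⟨_, hbody i hi s hs h3, (PMF.pure_bind _ _).symm⟩) hP

theorem computes_unmark (hs : Holds G r σ s) :
    Computes unmark (4 * n + 3) s fun s' => Holds G r σ s' ∧ ∀ v < n, s'.arr 4 v = 0 := by
  refine computes_forEach (T := 1)
    (P := fun i s => Holds G r σ s ∧ ∀ v < i, s.arr 4 v = 0) (fun i s hs => hs.1.vertices)
    (fun i hi s ⟨hs, hv⟩ h3 => ?_) ⟨hs.setReg (by omega) (by omega) _, by simp⟩
  refine computes_of_run (s' := s.setArr 4 i 0) (fun k => by simp [run, step, h3, hs.zero])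
    ⟨⟨(hs.setMark _ _).setReg (by omega) (by omega) _, fun v hvi => ?_⟩, h3⟩
  obtain rfl | hne := eq_or_ne v i
  · simp [Store.setReg, Store.setArr]
  · simp [Store.setReg, Store.setArr, hne, hv v (by omega)]

theorem computes_mark (hs : Holds G r σ s) (hunmarked : ∀ v < n, s.arr 4 v = 0) :
    Computes mark (9 * m + 3) s fun s' =>
      Holds G r σ s' ∧ ∀ v : Fin n, s'.arr 4 v = 0 ↔ G.IsSink σ v := by
  have hloop : Computes mark (9 * m + 3) s fun s' => Holds G r σ s' ∧
      ∀ v : Fin n, s'.arr 4 v = 0 ↔ ∀ e : Fin m, e < m → G.tail σ e ≠ v := by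
    refine computes_forEach (T := 6) (P := fun i s => Holds G r σ s ∧
      ∀ v : Fin n, s.arr 4 v = 0 ↔ ∀ e : Fin m, e < i → G.tail σ e ≠ v)
      (fun i s hs => hs.1.edges) (fun i hi s ⟨hs, hv⟩ h3 => ?_)
      ⟨hs.setReg (by omega) (by omega) _, fun v => by simp [Store.setReg, hunmarked]⟩
    obtain ⟨e, rfl⟩ : ∃ e : Fin m, e.val = i := ⟨⟨i, hi⟩, rfl⟩
    refine (computes_loadTail hs h3).seq (U := 1) fun s' hs' => ?_
    have hs'' : Holds G r σ s' :=
      hs' ▸ (hs.setReg (by omega) (by omega) _).setReg (by omega) (by omega) _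
    refine computes_of_run (s' := s'.setArr 4 (G.tail σ e) m) (fun k => ?_)
      ⟨⟨(hs''.setMark _ _).setReg (by omega) (by omega) _, fun v => ?_⟩, ?_⟩
    · simp [block, run, step, hs', Store.setReg, hs.edges]
    · have hm : m ≠ 0 := by omega
      have hmarks : s'.arr 4 v = 0 ↔ ∀ e' : Fin m, e' < e → G.tail σ e' ≠ v := by
        simpa [hs', Store.setReg] using hv v
      simp only [Nat.lt_succ_iff_lt_or_eq, or_imp, forall_and, Fin.val_fin_lt, Fin.val_inj,
        forall_eq, ← hmarks]
      obtain rfl | hne := eq_or_ne v (G.tail σ e)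
      · simp [Store.setReg, Store.setArr, hm]
      · simp [Store.setReg, Store.setArr, Fin.val_ne_iff.2 hne, hne.symm]
    · simp [hs', Store.setReg, Store.setArr, h3]
  exact hloop.mono le_rfl fun _ s' ⟨hs', hv⟩ => ⟨hs', fun v => by simp [hv, IsSink]⟩

theorem executes_toss (hs : Holds G r σ s) {e : Fin m} (he : s.reg 3 = e) :
    Executes toss 3 s (resample {e} σ) fun ρ s' => Holds G r ρ s' ∧ s'.reg 3 = s.reg 3 ∧
      s'.arr 4 = s.arr 4 ∧ ∀ e' ≠ e, ρ e' = σ e' := by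
  rw [resample_singleton, ← PMF.bind_pure_comp]
  refine (executes_flip 4 s).seq fun b s' hs' =>
    (computes_of_run (T := 1) (s' := s'.setArr 3 e b.toNat) (fun k => ?_) rfl).executes
      fun s'' hs'' => ?_
  · simp [block, run, step, hs', Store.setReg, he]
  · subst hs' hs''
    exact ⟨(hs.setReg (by omega) (by omega) _).setOrientation e b, by simp [Store.setArr,
      Store.setReg], by simp [Store.setArr, Store.setReg], fun e' he' => by simp [he']⟩

theorem executes_resampleHead (hs : Holds G r σ s) {e : Fin m} (he : s.reg 3 = e)
    {D : Finset (Fin m)} (hD : s.arr 4 (G.head σ e) = 0 ↔ e ∈ D) :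
    Executes (block [loadEndpoint 0 1, .load 5 4 5, .ite (.eq 5 2) toss .skip]) 11 s
      (resample (D.filter fun e' => e' = e) σ) fun ρ s' => Holds G r ρ s' ∧ s'.reg 3 = s.reg 3 ∧
        s'.arr 4 = s.arr 4 ∧ ∀ e' ≠ e, ρ e' = σ e' := by
  have hload : Computes (.load 5 4 5) 1 ((s.setReg 4 (σ e).toNat).setReg 5 (G.head σ e))
      fun s' => Holds G r σ s' ∧ s'.reg 3 = s.reg 3 ∧ s'.arr 4 = s.arr 4 ∧
        (Test.eval s' (.eq 5 2) = true ↔ e ∈ D) := by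
    refine computes_of_run (fun k => PMF.pure_bind _ _)
      ⟨((hs.setReg ?_ ?_ _).setReg ?_ ?_ _).setReg ?_ ?_ _, ?_, ?_, ?_⟩ <;>
      simp [Store.setReg, Test.eval, hs.zero, hD]
  refine (computes_loadHead hs he).seq (U := 6) fun s' hs' => hs' ▸ hload.seq (U := 4)
    fun s' ⟨hs', h3, h4, hu⟩ => .ite ?_
  rw [Finset.filter_eq']
  split_ifs with hunmarked heD heD
  · simpa only [h3, h4] using executes_toss hs' (h3.trans he)
  · exact absurd (hu.1 hunmarked) heD
  · exact absurd (hu.2 heD) hunmarked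
  · rw [resample_empty]
    have hskip : Computes .skip 1 s' (· = s') :=
      computes_of_run (fun k => PMF.pure_bind _ _) rfl
    exact (hskip.executes fun s'' hs'' => hs'' ▸ ⟨hs', h3, h4, fun _ _ => rfl⟩).mono
      (by omega) fun _ _ => id

theorem executes_resampleUnmarked (hs : Holds G r σ s) {D : Finset (Fin m)}
    (hD : ∀ e, s.arr 4 (G.head σ e) = 0 ↔ e ∈ D) :
    Executes resampleUnmarked (14 * m + 3) s (resample D σ) (Holds G r) := by
  have hloop := executes_forEach (x := 1) (T := 11) (N := m) (s := s) (b := σ)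
    (P := fun i σ s => Holds G r σ s ∧
      ∀ e : Fin m, i ≤ e → (s.arr 4 (G.head σ e) = 0 ↔ e ∈ D))
    (L := fun i => resample (D.filter fun e => i ≤ e.val))
    (p := block [loadEndpoint 0 1, .load 5 4 5, .ite (.eq 5 2) toss .skip])
    (fun i σ s hs => hs.1.edges)
    (fun σ => by
      rw [Finset.filter_false_of_mem fun e _ => not_le.2 e.isLt, resample_empty])
    (fun i hi σ s ⟨hs, hD⟩ h3 => ?_) ⟨hs.setReg (by omega) (by omega) _, fun e _ => hD e⟩
  · simp only [zero_le, Finset.filter_true] at hloop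
    exact hloop.mono le_rfl fun _ _ h => h.1
  · obtain ⟨e, rfl⟩ : ∃ e : Fin m, e.val = i := ⟨⟨i, hi⟩, rfl⟩
    refine ⟨_, (executes_resampleHead hs h3 (hD e le_rfl)).mono le_rfl
      fun ρ s' ⟨hs', h3', h4, hρ⟩ => ⟨⟨hs'.setReg (by omega) (by omega) _, fun e' he' => ?_⟩,
        h3'.trans h3⟩, ?_⟩
    · have hne : e' ≠ e := Fin.val_ne_iff.1 (by omega)
      simpa [Store.setReg, h4, head, hρ e' hne] using hD e' (by omega)
    · rw [resample_bind_resample, ← Finset.filter_or]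
      congr 2
      ext e'
      rw [← Fin.val_inj]
      omega

theorem executes_round (hs : Holds G (r + 1) σ s) :
    Executes round (23 * m + 4 * n + 13) s (G.popSinks σ) (Holds G r) := by
  have hdec : Computes (.dec 6) 1 s (Holds G r σ) :=
    computes_of_run (fun k => by simp [run, step, hs.rounds]) (hs.setRounds r)
  have hround := hdec.seq fun s hs => (computes_unmark hs).seq fun s hs =>
    (computes_mark hs.1 hs.2).seq fun s hs =>
      executes_resampleUnmarked hs.1 (D := G.sinkEdges σ) fun e => by simp [hs.2, sinkEdges]
  exact hround.mono (by omega) fun _ _ => id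

theorem executes_rounds (hs : Holds G r σ s) :
    Executes (.while (.ne 6 2) round) ((23 * m + 4 * n + 14) * r + 1) s (G.iteratePopSinks r σ)
      (Holds G 0) :=
  executes_while (P := Holds G)
    (fun σ s hs => ⟨by simp [Test.eval, hs.rounds, hs.zero], rfl⟩)
    (fun r σ s hs => ⟨by simp [Test.eval, hs.rounds, hs.zero], _, executes_round hs, rfl⟩) hs

/-- Add three to register `6`. -/
def addThree : Program := block [.inc 6, .inc 6, .inc 6]

/-- Add three times the number of leading zeros of array `2` to register `6`. -/
def countDigits : Program :=
  block [.const 3 0, .load 4 2 3, .while (.eq 4 2) (block [.inc 3, addThree, .load 4 2 3])]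

/-- Add `3 ⌈log₂ n⌉` to register `6`, by doubling register `7` until it reaches `n`. -/
def countVertices : Program :=
  block [.const 7 1, .while (.lt 7 0)
    (block [.copy 8 7, .while (.ne 8 2) (block [.inc 7, .dec 8]), addThree])]

/-- The sampling program: sink popping from a uniformly random orientation, for
`3 (⌈log₂ n⌉ + D + 1)` rounds if the binary expansion of `ε` has `D` leading zeros. -/
def program : Program :=
  block [countDigits, countVertices, addThree, unmark, resampleUnmarked, .while (.ne 6 2) round]

theorem computes_addThree (hs : Holds G r σ s) {a : ℕ} (h7 : s.reg 7 = a) :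
    Computes addThree 5 s fun s' => Holds G (r + 3) σ s' ∧ s'.reg 7 = a :=
  computes_of_run (s' := s.setReg 6 (r + 3))
    (fun k => by simp [addThree, block, run, step, Store.setReg, hs.rounds])
    ⟨hs.setRounds _, by simpa [Store.setReg] using h7⟩

theorem computes_countDigits (hs : Holds G r σ s) {D : ℕ} (hzero : ∀ i < D, s.arr 2 i = 0)
    (hD : s.arr 2 D ≠ 0) : Computes countDigits (10 * D + 5) s (Holds G (r + 3 * D) σ) := by
  have hloop := computes_while (t := .eq 4 2) (p := block [.inc 3, addThree, .load 4 2 3])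
    (P := fun j s' => ∃ i, i + j = D ∧ Holds G (r + 3 * i) σ s' ∧ s'.reg 3 = i ∧
      s'.reg 4 = s.arr 2 i ∧ s'.arr = s.arr) (T := 9) (j := D)
    (s := (s.setReg 3 0).setReg 4 (s.arr 2 0))
    (fun s' ⟨i, hi, hs', _, h4, _⟩ => by
      obtain rfl : i = D := hi
      simpa [Test.eval, h4, hs'.zero] using hD)
    (fun j s' ⟨i, hi, hs', h3, h4, harr⟩ => ⟨?_, ?_⟩)
    ⟨0, zero_add D, (hs.setReg (by omega) (by omega) _).setReg (by omega) (by omega) _,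
      by simp [Store.setReg], by simp [Store.setReg], rfl⟩
  · have hinit : Computes (.const 3 0) 1 s (· = s.setReg 3 0) :=
      computes_of_run (fun k => PMF.pure_bind _ _) rfl
    have hload : Computes (.load 4 2 3) 1 (s.setReg 3 0)
        (· = (s.setReg 3 0).setReg 4 (s.arr 2 0)) :=
      computes_of_run (fun k => by simp [run, step, Store.setReg]) rfl
    exact (hinit.seq fun s' hs' => hs' ▸ hload.seq fun s' hs' => hs' ▸ hloop).mono (by omega)
      fun _ s' ⟨_, hi, hs', _⟩ => hi ▸ hs'
  · simp [Test.eval, h4, hs'.zero, hzero i (by omega)]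
  · refine computes_of_run
      (s' := ((s'.setReg 3 (i + 1)).setReg 6 (r + 3 * i + 3)).setReg 4 (s.arr 2 (i + 1)))
      (fun k => ?_)
      ⟨i + 1, by omega, ((hs'.setReg (by omega) (by omega) _).setRounds _).setReg (by omega)
        (by omega) _, ?_⟩ <;>
      simp [addThree, block, run, step, Store.setReg, h3, harr, hs'.rounds]

theorem computes_double (hs : Holds G r σ s) {a : ℕ} (h7 : s.reg 7 = a) (h8 : s.reg 8 = a) :
    Computes (.while (.ne 8 2) (block [.inc 7, .dec 8])) (4 * a + 1) s
      fun s' => Holds G r σ s' ∧ s'.reg 7 = 2 * a := by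
  refine (computes_while (T := 3) (j := a)
    (P := fun j s' => Holds G r σ s' ∧ s'.reg 8 = j ∧ s'.reg 7 + j = 2 * a)
    (fun s' ⟨hs', h8, _⟩ => by simp [Test.eval, h8, hs'.zero])
    (fun j s' ⟨hs', h8, h7⟩ => ⟨by simp [Test.eval, h8, hs'.zero], ?_⟩)
    ⟨hs, h8, by omega⟩).mono le_rfl fun _ s' ⟨hs', _, h7⟩ => ⟨hs', h7⟩
  refine computes_of_run (s' := (s'.setReg 7 (s'.reg 7 + 1)).setReg 8 j)
    (fun k => by simp [block, run, step, Store.setReg, h8])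
    ⟨(hs'.setReg (by omega) (by omega) _).setReg (by omega) (by omega) _, ?_, ?_⟩
  · simp [Store.setReg]
  · simp [Store.setReg, Nat.add_right_comm _ 1 j, ← h7, add_assoc]

theorem computes_countVertices (hs : Holds G r σ s) :
    Computes countVertices ((4 * n + 10) * Nat.clog 2 n + 3) s
      (Holds G (r + 3 * Nat.clog 2 n) σ) := by
  have hconst : Computes (.const 7 1) 1 s (· = s.setReg 7 1) :=
    computes_of_run (fun k => PMF.pure_bind _ _) rfl
  refine (hconst.seq fun s' hs' => hs' ▸ computes_while (T := 4 * n + 9) (j := Nat.clog 2 n)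
    (P := fun j s' => ∃ i, i + j = Nat.clog 2 n ∧ Holds G (r + 3 * i) σ s' ∧ s'.reg 7 = 2 ^ i)
    (fun s' ⟨i, hi, hs', h7⟩ => ?_) (fun j s' ⟨i, hi, hs', h7⟩ => ?_)
    ⟨0, zero_add _, hs.setReg (by omega) (by omega) _, by simp [Store.setReg]⟩).mono
    (le_of_eq (by ring)) fun _ s' ⟨_, hi, hs', _⟩ => hi ▸ hs'
  · simpa [Test.eval, h7, hs'.vertices, ← hi] using Nat.le_pow_clog one_lt_two n
  · have hlt : 2 ^ i < n := Nat.pow_lt_of_lt_clog (by omega)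
    have hcopy : Computes (.copy 8 7) 1 s' (· = s'.setReg 8 (2 ^ i)) :=
      computes_of_run (fun k => by simp [run, step, h7]) rfl
    have hbody := hcopy.seq fun s hs => hs ▸ (computes_double (a := 2 ^ i)
      (hs'.setReg (by omega) (by omega) _) (by simpa [Store.setReg] using h7)
      (by simp [Store.setReg])).seq fun s hs => computes_addThree hs.1 hs.2
    refine ⟨by simpa [Test.eval, h7, hs'.vertices], hbody.mono (by omega) ?_⟩
    exact fun _ s' ⟨hs', h7⟩ => ⟨i + 1, by omega, hs', by rw [h7, pow_succ']⟩

theorem holds_input (ε : ℝ) : Holds G 0 (fun _ => false) (G.input ε) where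
  vertices := rfl
  edges := rfl
  zero := rfl
  rounds := rfl
  fst e := by simp [input]
  snd e := by simp [input]
  orientation _ := rfl

theorem executes_program {ε : ℝ} {D : ℕ} (hzero : ∀ i < D, Real.digits ε 2 i = 0)
    (hD : Real.digits ε 2 D ≠ 0) :
    Executes program
      ((23 * m + 4 * n + 14) * (3 * (Nat.clog 2 n + D + 1)) + (4 * n + 10) * Nat.clog 2 n +
        10 * D + 4 * n + 14 * m + 25) (G.input ε)
      ((PMF.uniformOfFintype G.Orientation).bind
        (G.iteratePopSinks (3 * (Nat.clog 2 n + D + 1)))) (Holds G 0) := by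
  have hdigits := computes_countDigits (holds_input (G := G) ε) (D := D)
    (fun i hi => by simp [input, hzero i hi]) (by simpa [input] using hD)
  have hrun := hdigits.seq fun s hs => (computes_countVertices hs).seq fun s hs =>
    (computes_addThree hs rfl).seq fun s hs => (computes_unmark hs.1).seq fun s hs =>
      (executes_resampleUnmarked hs.1 (D := Finset.univ) fun e => by simp [hs.2]).seq
        fun σ s hs => executes_rounds hs
  rw [resample_univ] at hrun
  rw [show 3 * (Nat.clog 2 n + D + 1) = 0 + 3 * D + 3 * Nat.clog 2 n + 3 by ring]
  exact hrun.mono (by ring_nf; omega) fun _ _ => id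

theorem Holds.output_eq (hs : Holds G r σ s) (k : List Program) : G.output (k, s) = σ := by
  funext e
  cases h : σ e <;> simp [output, hs.orientation, h]

end SinkPopping

/-! ## Accuracy and running time -/

theorem digits_two_eq_zero {ε : ℝ} {i D : ℕ} (hε : 0 ≤ ε) (hD : ε * 2 ^ D < 1) (hi : i < D) :
    Real.digits ε 2 i = 0 := by
  have hlt : ε * ((2 : ℕ) : ℝ) ^ (i + 1) < 1 :=
    calc ε * ((2 : ℕ) : ℝ) ^ (i + 1) ≤ ε * 2 ^ D := by
          rw [Nat.cast_ofNat]
          gcongr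
          · exact one_le_two
          · exact hi
      _ < 1 := hD
  rw [Real.digits, Nat.floor_eq_zero.2 hlt]
  rfl

theorem digits_two_ne_zero {ε : ℝ} {i : ℕ} (h₁ : ε * 2 ^ i < 1) (h₂ : 1 ≤ ε * 2 ^ (i + 1)) :
    Real.digits ε 2 i ≠ 0 := by
  have hfloor : ⌊ε * ((2 : ℕ) : ℝ) ^ (i + 1)⌋₊ = 1 := by
    rw [Nat.floor_eq_iff (by push_cast; linarith)]
    push_cast
    exact ⟨h₂, by rw [pow_succ]; linarith⟩
  rw [Real.digits, hfloor]
  decide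

theorem exists_mul_two_pow_lt_one_le {ε : ℝ} (h0 : 0 < ε) (h1 : ε < 1) :
    ∃ D : ℕ, ε * 2 ^ D < 1 ∧ 1 ≤ ε * 2 ^ (D + 1) := by
  obtain ⟨k, hk⟩ := pow_unbounded_of_one_lt (1 / ε) one_lt_two
  have hex : ∃ k : ℕ, 1 ≤ ε * 2 ^ k := ⟨k, ((div_lt_iff₀' h0).1 hk).le⟩
  have hne : Nat.find hex ≠ 0 := by simpa [Nat.find_eq_zero] using h1
  refine ⟨Nat.find hex - 1, not_le.1 (Nat.find_min hex (Nat.sub_one_lt hne)), ?_⟩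
  rw [Nat.sub_one_add_one hne]
  exact Nat.find_spec hex

theorem pow_mul_le_of_le_two_pow {n l D : ℕ} {ε : ℝ} (hn : n ≤ 2 ^ l)
    (hD : 1 ≤ ε * 2 ^ (D + 1)) : (25 / 32 : ℝ) ^ (3 * (l + D + 1)) * n ≤ ε := by
  have hn' : (n : ℝ) ≤ 2 ^ l := by exact_mod_cast hn
  calc (25 / 32 : ℝ) ^ (3 * (l + D + 1)) * n ≤ (1 / 2) ^ (l + D + 1) * 2 ^ l := by
        rw [pow_mul]
        gcongr
        norm_num
    _ = (1 / 2) ^ (D + 1) := by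
        rw [add_assoc, pow_add, mul_right_comm, ← mul_pow]
        norm_num
    _ ≤ (1 / 2) ^ (D + 1) * (ε * 2 ^ (D + 1)) := le_mul_of_one_le_right (by positivity) hD
    _ = ε := by
        rw [mul_left_comm, ← mul_pow]
        norm_num

theorem two_pow_clog_le {n m : ℕ} (hnm : n ≤ m) (hm : 0 < m) : 2 ^ Nat.clog 2 n ≤ 2 * m := by
  obtain h | h := le_or_gt n 1
  · rw [Nat.clog_of_right_le_one h]
    omega
  · have hlt := Nat.pow_pred_clog_lt_self one_lt_two h
    have hpos := Nat.clog_pos one_lt_two h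
    rw [Nat.pred_eq_sub_one] at hlt
    rw [← Nat.sub_one_add_one hpos.ne', pow_succ']
    gcongr
    exact (hlt.trans_le hnm).le

theorem clog_add_le_log {n m D : ℕ} {ε : ℝ} (hnm : n ≤ m) (hm : 2 ≤ m) (h0 : 0 < ε)
    (h1 : ε < 1) (hD : ε * 2 ^ D < 1) :
    ((Nat.clog 2 n + D + 1 : ℕ) : ℝ) ≤ 6 * Real.log (m / ε) := by
  have hm' : (2 : ℝ) ≤ m := by exact_mod_cast hm
  have hx : 2 ≤ m / ε := hm'.trans (le_div_self (Nat.cast_nonneg m) h0 h1.le)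
  have hclog : (2 : ℝ) ^ Nat.clog 2 n ≤ 2 * m := by
    exact_mod_cast two_pow_clog_le hnm (two_pos.trans_le hm)
  have hD' : (2 : ℝ) ^ D ≤ 1 / ε := (le_div_iff₀' h0).2 hD.le
  have hpow : (2 : ℝ) ^ (Nat.clog 2 n + D + 1) ≤ (m / ε) ^ 3 :=
    calc (2 : ℝ) ^ (Nat.clog 2 n + D + 1) = 2 ^ Nat.clog 2 n * 2 ^ D * 2 := by ring
      _ ≤ 2 * m * (1 / ε) * 2 := by gcongr
      _ = 2 * 2 * (m / ε) := by ring
      _ ≤ (m / ε) * (m / ε) * (m / ε) := by gcongr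
      _ = (m / ε) ^ 3 := by ring
  have hlog := Real.log_le_log (by positivity) hpow
  rw [Real.log_pow, Real.log_pow] at hlog
  have hhalf : ((Nat.clog 2 n + D + 1 : ℕ) : ℝ) * (1 / 2) ≤
      (Nat.clog 2 n + D + 1 : ℕ) * Real.log 2 := by
    gcongr
    linarith [Real.log_two_gt_d9]
  push_cast at *
  linarith

theorem steps_le {n m l D : ℕ} (hnm : n ≤ m) (hm : 2 ≤ m) :
    (23 * m + 4 * n + 14) * (3 * (l + D + 1)) + (4 * n + 10) * l + 10 * D + 4 * n + 14 * m + 25 ≤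
      133 * (m * (l + D + 1)) := by
  have hround : (23 * m + 4 * n + 14) * (3 * (l + D + 1)) ≤ 34 * m * (3 * (l + D + 1)) := by
    gcongr
    omega
  have hclog : (4 * n + 10) * l ≤ 9 * m * l := by
    gcongr
    omega
  have hD : D * 2 ≤ D * m := by gcongr
  nlinarith [Nat.zero_le (m * l)]

theorem steps_le_log {n m D : ℕ} {ε : ℝ} (hnm : n ≤ m) (hm : 2 ≤ m) (h0 : 0 < ε)
    (h1 : ε < 1) (hD : ε * 2 ^ D < 1) :
    (((23 * m + 4 * n + 14) * (3 * (Nat.clog 2 n + D + 1)) + (4 * n + 10) * Nat.clog 2 n +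
      10 * D + 4 * n + 14 * m + 25 : ℕ) : ℝ) ≤ 133 * 6 * (m * Real.log (m / ε)) :=
  calc _ ≤ ((133 * (m * (Nat.clog 2 n + D + 1)) : ℕ) : ℝ) := Nat.cast_le.2 (steps_le hnm hm)
    _ = 133 * (m * ((Nat.clog 2 n + D + 1 : ℕ) : ℝ)) := by push_cast; ring
    _ ≤ 133 * (m * (6 * Real.log (m / ε))) := by
        gcongr
        exact clog_add_le_log hnm hm h0 h1 hD
    _ = 133 * 6 * (m * Real.log (m / ε)) := by ring

namespace EdgeListGraph

variable {n m : ℕ} {G : EdgeListGraph n m}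

theorem sum_degree (G : EdgeListGraph n m) : ∑ v, G.degree v = 2 * m := by
  have hcount (f : Fin m → Fin n) : ∑ v, (Finset.univ.filter fun e => f e = v).card = m := by
    rw [← Finset.card_eq_sum_card_fiberwise fun _ _ => Finset.mem_coe.2 (Finset.mem_univ _),
      Finset.card_univ, Fintype.card_fin]
  simp only [degree, Finset.sum_add_distrib, hcount, two_mul]

theorem mul_le_two_mul_of_le_degree {d : ℕ} (hG : ∀ v, d ≤ G.degree v) : n * d ≤ 2 * m := by
  rw [← G.sum_degree]
  simpa using Finset.card_nsmul_le_sum Finset.univ G.degree d fun v _ => hG v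

end EdgeListGraph

theorem theorem2 :
    ∃ (p : RAM.Program) (C : ℝ), ∀ (n m : ℕ) (G : EdgeListGraph n m) (ε : ℝ),
      0 < n → (∀ v, 3 ≤ G.degree v) → 0 < ε → ε < 1 →
      ∃ (hΩ : G.sinkFree.Nonempty) (t : ℕ),
        (t : ℝ) ≤ C * (m * Real.log (m / ε)) ∧
        (∀ c ∈ (RAM.run t ([p], G.input ε)).support, RAM.Halted c) ∧
        tvDist (G.outputDist ε p t) (PMF.uniformOfFinset G.sinkFree hΩ) ≤ ε := by
  refine ⟨SinkPopping.program, 133 * 6, fun n m G ε hn hG h0 h1 => ?_⟩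
  have hΩ : G.sinkFree.Nonempty := by
    rw [← EdgeListGraph.sinkFreeOn_univ]
    exact EdgeListGraph.sinkFreeOn_nonempty hG _
  have hnm : n * 3 ≤ 2 * m := EdgeListGraph.mul_le_two_mul_of_le_degree hG
  obtain ⟨D, hD, hD'⟩ := exists_mul_two_pow_lt_one_le h0 h1
  obtain ⟨hhalted, houtput⟩ := (SinkPopping.executes_program (G := G)
    (fun _ hi => digits_two_eq_zero h0.le hD hi) (digits_two_ne_zero hD hD')).run
    (o := G.output) fun σ s hs => hs.output_eq []
  refine ⟨hΩ, _, steps_le_log (by omega) (by omega) h0 h1 hD, hhalted, ?_⟩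
  rw [EdgeListGraph.outputDist, houtput]
  exact (EdgeListGraph.tvDist_uniform_bind_iteratePopSinks_le hG hΩ _).trans
    (pow_mul_le_of_le_two_pow (Nat.le_pow_clog one_lt_two n) hD')
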